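/- Let $\mathcal A$ be a non-degenerate complete Boolean algebra, and for $a\in\mathcal A$ let $p(a)$ be the set of all families $(a_i)$ in $\mathcal A$ with $\bigvee a_i=a$ and $a_i\wedge a_j=0$ for $i\ne j$. A *conditional set* $X$ on $\mathcal A$ consists of sets $X_a$ and surjections $\gamma_a:X_1\to X_a$ ($a\in\mathcal A$; write $ax:=\gamma_a(x)$) such that $X_0$ is a singleton, $\gamma_1=\mathrm{id}$, $bx=by$ and $a\le b$ imply $ax=ay$, and for all $(a_i)\in p(1)$ and $(x_i)\in\prod X_{a_i}$ there is a unique $x=\sum a_ix_i\in X_1$ with $a_ix=x_i$ for all $i$. Products are formed componentwise. Conditional subsets living on $1$ are the non-empty subsets $Y$ of $X_1$ containing every $x$ for which there are $(a_i)\in p(1)$ and $y_i\in Y$ with $a_ix=a_iy_i$ for all $i$; then $Y_a=\gamma_a(Y)$. A conditional relation between $X$ and $Y$ is a conditional subset of $X\times Y$ living on $1$; a conditional function is a conditional relation all of whose components are graphs of functions $X_a\to Y_a$; it is conditionally bijective if all components are injective and the one at $1$ is surjective. A conditional relation is a conditional equivalence relation or partial order if its component at $1$ is a classical one; the quotient of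 $X$ by a conditional equivalence relation $\sim$ has components $X_a/{\sim_a}$. For a conditional partial order, $x<_ay$ in $X_a$ means $x\le_a y$ and $bx=by$ only for $b=0$ ($b\le a$); the order is *conditionally total* if for all $x,y\in X_1$ there is $(a,b,c)\in p(1)$ with $ax<_a ay$, $by<_b bx$ and $cx=cy$. A *conditionally ordered field* is a conditional set $K$ with conditional functions $+,\cdot:K\times K\to K$ and a conditional total order $\leqslant$ such that $(K_1,+,\cdot)$ is a commutative ring with unit; $a1=a0$ holds only for $a=0$; every $x\in K_1$ such that $ax=a0$ only for $a=0$ has an inverse with the same property; $x<y$ implies $x+z<y+z$; and $x,y>0$ implies $xy>0$. A *conditionally ordered subfield* is a conditional subset living on $1$, closed under $+$ and $\cdot$, which is a conditionally ordered field for the restricted operations and order. Let $\mathbf N$ and $\mathbf Q$ be the conditional sets generated by $\mathbb N$ and $\mathbb Q$: the elements of their $a$-component are the formal sums $\sum a_ix_i$ with $(a_i)\in p(a)$ and $x_i$ in $\mathbb N$ (in $\mathbb Q$), two sums being identified if $\bigvee\{a_i:x_i=z\}=\bigvee\{b_j:y_j=z\}$ for all $z$. Operations and orders are the generated ones: $\sum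 a_ix_i+\sum b_jy_j=\sum (a_i\wedge b_j)(x_i+y_j)$, similarly for products, and $\sum a_ix_i\leqslant\sum b_jy_j$ iff $x_i\le y_j$ whenever $a_i\wedge b_j\neq0$. A conditional sequence $(q_n)$ is a conditional function $\mathbf N\to\mathbf Q$. It is *conditionally Cauchy* if for every $\varepsilon>0$ in $\mathbf Q$ there is $n_0\in\mathbf N$ with $|q_n-q_m|<\varepsilon$ for all $m,n\geqslant n_0$ in $\mathbf N$, and $q_n\to0$ means that for every $\varepsilon>0$ in $\mathbf Q$ there is $n_0\in\mathbf N$ with $|q_n|<\varepsilon$ for all $n\geqslant n_0$. Let $\mathcal C$ be the conditional set of conditional Cauchy sequences in $\mathbf Q$, let $(q_n)\sim(p_n)$ mean $q_n-p_n\to0$, and let $\mathbf R:=\mathcal C/{\sim}$ with $[(q_n)]+[(p_n)]:=[(q_n+p_n)]$, $[(q_n)]\cdot[(p_n)]:=[(q_np_n)]$, and $[(p_n)]\leqslant[(q_n)]$ if for every $\varepsilon>0$ in $\mathbf Q$ there is $n_0\in\mathbf N$ with $q_n-p_n>-\varepsilon$ for all $n\geqslant n_0$. **Theorem.** $(\mathbf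 R,+,\cdot,\leqslant)$ is a conditionally ordered field. Moreover, $(\mathbf Q,+,\cdot,\leqslant)$ is isomorphic, by a conditional bijection preserving $+$ and $\cdot$ and preserving and reflecting $\leqslant$, to a conditionally ordered subfield of $(\mathbf R,+,\cdot,\leqslant)$. -/

import Mathlib

universe u v w

/-- `IsPartition a f` says `(f i)ᵢ ∈ p(a)`: the `f i` are pairwise disjoint with supremum `a`
(some of the `f i` may be `⊥`). -/
def IsPartition {A : Type u} [CompleteBooleanAlgebra A] {I : Type w} (a : A) (f : I → A) : Prop :=
  (∀ i j, i ≠ j → f i ⊓ f j = ⊥) ∧ ⨆ i, f i = a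

/-- A conditional set on a complete Boolean algebra `A`. Since all nonzero members of a partition
are distinct and `obj ⊥` is a singleton, index types in the universe of `A` suffice in
`stability`. -/
structure CondSet (A : Type u) [CompleteBooleanAlgebra A] where
  obj : A → Type v
  γ : (a : A) → obj ⊤ → obj a
  singleton_bot : ∃ x : obj ⊥, ∀ y : obj ⊥, y = x
  surjective : ∀ a, Function.Surjective (γ a)
  identity : ∀ x, γ ⊤ x = x
  consistency : ∀ a b, a ≤ b → ∀ x y, γ b x = γ b y → γ a x = γ a y
  stability : ∀ (I : Type u) (a : I → A), IsPartition ⊤ a → ∀ x : (i : I) → obj (a i),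
    ∃! z : obj ⊤, ∀ i, γ (a i) z = x i

namespace CondSet

variable {A : Type u} [CompleteBooleanAlgebra A]

theorem two_partition (a : A) :
    IsPartition ⊤ (fun i : ULift.{u} Bool => if i.down then a else aᶜ) := by
  refine ⟨?_, ?_⟩
  · rintro ⟨i⟩ ⟨j⟩ h
    cases i <;> cases j <;> simp_all
  · apply le_antisymm le_top
    rw [← sup_compl_eq_top (x := a)]
    exact sup_le (le_iSup_of_le ⟨true⟩ (by simp)) (le_iSup_of_le ⟨false⟩ (by simp))

/-- Two elements can be glued along `a` and its complement. -/
theorem exists_mix (X : CondSet.{u, v} A) (a : A) (x y : X.obj ⊤) :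
    ∃ z, X.γ a z = X.γ a x ∧ X.γ aᶜ z = X.γ aᶜ y := by
  obtain ⟨z, hz, -⟩ := X.stability _ _ (two_partition a)
    (fun i => X.γ _ (if i.down then x else y))
  have h1 := hz ⟨true⟩
  have h2 := hz ⟨false⟩
  simp only [if_true] at h1
  simp only [Bool.false_eq_true, if_false] at h2
  exact ⟨z, h1, h2⟩

/-- Elements which agree on every member of a partition are equal. -/
theorem eq_of_partition (X : CondSet.{u, v} A) {I : Type u} {a : I → A} (ha : IsPartition ⊤ a)
    {x y : X.obj ⊤} (h : ∀ i, X.γ (a i) x = X.γ (a i) y) : x = y :=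
  (X.stability I a ha (fun i => X.γ (a i) y)).unique h (fun _ => rfl)

/-- Local version of `eq_of_partition`. -/
theorem eq_on_of_partition (X : CondSet.{u, v} A) {I : Type u} {a : I → A}
    (ha : IsPartition ⊤ a) (b : A) {x y : X.obj ⊤}
    (h : ∀ i, X.γ (a i ⊓ b) x = X.γ (a i ⊓ b) y) : X.γ b x = X.γ b y := by
  obtain ⟨z, hz, hz'⟩ := X.exists_mix b x y
  have hp : IsPartition ⊤ (fun i : Option I => i.elim bᶜ (fun i => a i ⊓ b)) := by
    refine ⟨?_, ?_⟩
    · rintro (_ | i) (_ | j) hij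
      · exact absurd rfl hij
      · exact le_bot_iff.1 ((inf_le_inf_left _ inf_le_right).trans (compl_inf_eq_bot (a := b)).le)
      · exact le_bot_iff.1 ((inf_le_inf_right _ inf_le_right).trans (inf_compl_eq_bot (a := b)).le)
      · exact le_bot_iff.1 ((inf_le_inf inf_le_left inf_le_left).trans
          (ha.1 i j fun e => hij (congrArg some e)).le)
    · rw [iSup_option]
      simp only [Option.elim]
      rw [← iSup_inf_eq, ha.2, top_inf_eq, compl_sup_eq_top]
  have : z = y := by
    refine X.eq_of_partition hp ?_
    rintro (_ | i)
    · exact hz'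
    · exact (X.consistency _ b inf_le_right _ _ hz).trans (h i)
  rw [← this, hz]

/-- The restriction map `γ^b_a : X_b → X_a`; it is only used for `a ≤ b`. -/
noncomputable def res (X : CondSet.{u, v} A) (a : A) {b : A} (x : X.obj b) : X.obj a :=
  X.γ a (Function.surjInv (X.surjective b) x)

theorem res_γ (X : CondSet.{u, v} A) {a b : A} (h : a ≤ b) (x : X.obj ⊤) :
    X.res a (X.γ b x) = X.γ a x :=
  X.consistency a b h _ _ (Function.surjInv_eq (X.surjective b) _)

theorem res_top (X : CondSet.{u, v} A) (a : A) (x : X.obj ⊤) : X.res a x = X.γ a x := by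
  have := X.res_γ (le_top : a ≤ ⊤) x
  rwa [X.identity] at this

/-- The conditional product of two conditional sets. -/
def prod (X : CondSet.{u, v} A) (Y : CondSet.{u, w} A) : CondSet.{u, max v w} A where
  obj a := X.obj a × Y.obj a
  γ a p := (X.γ a p.1, Y.γ a p.2)
  singleton_bot := by
    obtain ⟨x, hx⟩ := X.singleton_bot
    obtain ⟨y, hy⟩ := Y.singleton_bot
    exact ⟨(x, y), fun p => Prod.ext (hx _) (hy _)⟩
  surjective a p := by
    obtain ⟨x, hx⟩ := X.surjective a p.1
    obtain ⟨y, hy⟩ := Y.surjective a p.2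
    exact ⟨(x, y), Prod.ext hx hy⟩
  identity p := Prod.ext (X.identity _) (Y.identity _)
  consistency a b h p q e := Prod.ext
    (X.consistency a b h _ _ (congrArg Prod.fst e)) (Y.consistency a b h _ _ (congrArg Prod.snd e))
  stability I a ha p := by
    obtain ⟨x, hx, -⟩ := X.stability I a ha (fun i => (p i).1)
    obtain ⟨y, hy, -⟩ := Y.stability I a ha (fun i => (p i).2)
    refine ⟨(x, y), fun i => Prod.ext (hx i) (hy i), fun q hq => Prod.ext ?_ ?_⟩
    · exact X.eq_of_partition ha fun i => (congrArg Prod.fst (hq i)).trans (hx i).symm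
    · exact Y.eq_of_partition ha fun i => (congrArg Prod.snd (hq i)).trans (hy i).symm

/-! ### Conditional subsets living on `1` -/

/-- An element of `S(X)`, i.e. a conditional subset of `X` living on `1`, given by its primal set,
which is a non-empty stable subset of `X_1`: it contains every `x = ∑ aᵢ sᵢ` with `(aᵢ) ∈ p(1)`
and all `sᵢ` in it. -/
structure Stable (X : CondSet.{u, v} A) where
  primal : Set (X.obj ⊤)
  nonempty : primal.Nonempty
  stable : ∀ (I : Type u) (a : I → A), IsPartition ⊤ a → ∀ s : I → X.obj ⊤, (∀ i, s i ∈ primal) →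
    ∀ x, (∀ i, X.γ (a i) x = X.γ (a i) (s i)) → x ∈ primal

/-- The set `Y_a` of a conditional subset `Y` of `X`. -/
def Stable.at {X : CondSet.{u, v} A} (Y : X.Stable) (a : A) : Set (X.obj a) := X.γ a '' Y.primal

theorem Stable.mem_at_top {X : CondSet.{u, v} A} (Y : X.Stable) {x : X.obj ⊤} :
    x ∈ Y.at ⊤ ↔ x ∈ Y.primal := by
  constructor
  · rintro ⟨y, hy, rfl⟩
    rwa [X.identity]
  · exact fun h => ⟨x, h, X.identity x⟩

theorem Stable.mix {X : CondSet.{u, v} A} (Y : X.Stable) (a : A) {x y z : X.obj ⊤}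
    (hx : x ∈ Y.primal) (hy : y ∈ Y.primal) (h1 : X.γ a z = X.γ a x) (h2 : X.γ aᶜ z = X.γ aᶜ y) :
    z ∈ Y.primal := by
  refine Y.stable _ _ (two_partition a) (fun i => if i.down then x else y) ?_ z ?_
  · rintro ⟨i⟩; cases i <;> simpa
  · rintro ⟨i⟩; cases i
    · simpa using h2
    · simpa using h1

/-- A conditional subset living on `1`, as a conditional set. -/
def Stable.toCondSet {X : CondSet.{u, v} A} (Y : X.Stable) : CondSet.{u, v} A where
  obj a := {x : X.obj a // x ∈ Y.at a}
  γ a x := ⟨X.γ a x.1, x.1, Y.mem_at_top.1 x.2, rfl⟩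
  singleton_bot := by
    obtain ⟨x, hx⟩ := X.singleton_bot
    obtain ⟨y, hy⟩ := Y.nonempty
    exact ⟨⟨X.γ ⊥ y, y, hy, rfl⟩, fun z => Subtype.ext ((hx _).trans (hx _).symm)⟩
  surjective a := by
    rintro ⟨_, y, hy, rfl⟩
    exact ⟨⟨y, Y.mem_at_top.2 hy⟩, rfl⟩
  identity x := Subtype.ext (X.identity _)
  consistency a b h x y e := Subtype.ext (X.consistency a b h _ _ (congrArg Subtype.val e))
  stability I a ha x := by
    obtain ⟨z, hz, -⟩ := X.stability I a ha (fun i => (x i).1)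
    choose s hs hs' using fun i => (x i).2
    have hzm : z ∈ Y.primal := Y.stable I a ha s hs z fun i => (hz i).trans (hs' i).symm
    refine ⟨⟨z, Y.mem_at_top.2 hzm⟩, fun i => Subtype.ext (hz i), fun y hy => Subtype.ext ?_⟩
    exact X.eq_of_partition ha fun i => (congrArg Subtype.val (hy i)).trans (hz i).symm

/-! ### Conditional functions -/

/-- A conditional function `aX → aY`, given by its component at `a`. The condition says that the
component at each `b ≤ a` exists, i.e. that the graph, restricted to `b`, is the graph of a
function `X_b → Y_b`. -/
@[ext] structure Fun (X : CondSet.{u, v} A) (Y : CondSet.{u, w} A) (a : A) where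
  toFun : X.obj a → Y.obj a
  consistent : ∀ b ≤ a, ∀ x y, X.res b x = X.res b y → Y.res b (toFun x) = Y.res b (toFun y)

/-- A conditional function `X → Y`. -/
abbrev Hom (X : CondSet.{u, v} A) (Y : CondSet.{u, w} A) := Fun X Y ⊤

section Fun

variable {X : CondSet.{u, v} A} {Y : CondSet.{u, w} A}

theorem Fun.γ_eq (f : Hom X Y) {b : A} {x y : X.obj ⊤} (h : X.γ b x = X.γ b y) :
    Y.γ b (f.toFun x) = Y.γ b (f.toFun y) := by
  have := f.consistent b le_top x y
  simp only [res_top] at this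
  exact this h

/-- A conditional function from a function of primal sets compatible with all restrictions. -/
def Hom.mk' (f : X.obj ⊤ → Y.obj ⊤)
    (h : ∀ b x y, X.γ b x = X.γ b y → Y.γ b (f x) = Y.γ b (f y)) : Hom X Y where
  toFun := f
  consistent b _ x y := by simpa only [res_top] using h b x y

/-- The component `f_b : X_b → Y_b` of a conditional function `f : X → Y`. -/
noncomputable def Hom.comp (f : Hom X Y) (b : A) : X.obj b → Y.obj b :=
  fun x => Y.γ b (f.toFun (Function.surjInv (X.surjective b) x))

theorem Hom.comp_γ (f : Hom X Y) (b : A) (x : X.obj ⊤) :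
    f.comp b (X.γ b x) = Y.γ b (f.toFun x) :=
  f.γ_eq (Function.surjInv_eq (X.surjective b) _)

/-- Conditionally bijective: all components are injective, and the top one is surjective. -/
def Hom.Bijective (f : Hom X Y) : Prop :=
  (∀ b, Function.Injective (f.comp b)) ∧ Function.Surjective f.toFun

/-- The restriction `af : aX → aY` of a conditional function `f : X → Y`. -/
noncomputable def Hom.restrict (f : Hom X Y) (a : A) : Fun X Y a where
  toFun := f.comp a
  consistent b hb x y h := by
    obtain ⟨x, rfl⟩ := X.surjective a x
    obtain ⟨y, rfl⟩ := X.surjective a y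
    rw [X.res_γ hb, X.res_γ hb] at h
    rw [f.comp_γ, f.comp_γ, Y.res_γ hb, Y.res_γ hb]
    exact f.γ_eq h

theorem Hom.restrict_eq_iff {f g : Hom X Y} {a : A} :
    f.restrict a = g.restrict a ↔ ∀ x, Y.γ a (f.toFun x) = Y.γ a (g.toFun x) := by
  constructor
  · intro h x
    have := congrFun (congrArg Fun.toFun h) (X.γ a x)
    simpa only [Hom.restrict, Hom.comp_γ] using this
  · intro h
    ext x
    exact h _

/-- Conditional functions `aᵢX → aᵢY` glue along a partition `(aᵢ)`. -/
theorem exists_glue {I : Type u} {a : I → A} (ha : IsPartition ⊤ a) (f : (i : I) → Fun X Y (a i)) :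
    ∃ g : Hom X Y, ∀ i, g.restrict (a i) = f i := by
  choose g hg using fun x : X.obj ⊤ =>
    (Y.stability I a ha (fun i => (f i).toFun (X.γ (a i) x))).exists
  have key : ∀ b x y, X.γ b x = X.γ b y → Y.γ b (g x) = Y.γ b (g y) := by
    intro b x y h
    refine Y.eq_on_of_partition ha b fun i => ?_
    have e := (f i).consistent (a i ⊓ b) inf_le_left (X.γ (a i) x) (X.γ (a i) y)
      (by rw [X.res_γ inf_le_left, X.res_γ inf_le_left]
          exact X.consistency _ _ inf_le_right _ _ h)
    rwa [← hg, ← hg, Y.res_γ inf_le_left, Y.res_γ inf_le_left] at e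
  refine ⟨Hom.mk' g key, fun i => ?_⟩
  ext x
  obtain ⟨x, rfl⟩ := X.surjective _ x
  exact (Hom.comp_γ _ _ _).trans (hg x i)

end Fun

/-- The conditional set `M(X, Y)` of conditional functions from `X` to `Y`. -/
noncomputable def maps (X : CondSet.{u, v} A) (Y : CondSet.{u, w} A) :
    CondSet.{u, max v w} A where
  obj a := Fun X Y a
  γ a f := Hom.restrict f a
  singleton_bot := by
    obtain ⟨y, hy⟩ := Y.singleton_bot
    refine ⟨⟨fun _ => y, fun _ _ _ _ _ => rfl⟩, fun g => ?_⟩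
    ext x
    exact hy _
  surjective a f := by
    obtain ⟨y, -⟩ := Y.surjective ⊥ Y.singleton_bot.choose
    let c : (b : A) → Fun X Y b := fun b => ⟨fun _ => Y.γ b y, fun _ _ _ _ _ => rfl⟩
    obtain ⟨g, hg⟩ := exists_glue (two_partition a)
      (fun i => match i with | ⟨true⟩ => f | ⟨false⟩ => c aᶜ)
    exact ⟨g, hg ⟨true⟩⟩
  identity f := by
    ext x
    have := Hom.comp_γ f ⊤ x
    rwa [X.identity, Y.identity] at this
  consistency a b h f g e := by
    rw [Hom.restrict_eq_iff] at e ⊢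
    exact fun x => Y.consistency a b h _ _ (e x)
  stability I a ha f := by
    obtain ⟨g, hg⟩ := exists_glue ha f
    refine ⟨g, hg, fun k hk => ?_⟩
    have : ∀ i, Hom.restrict k (a i) = Hom.restrict g (a i) := fun i => (hk i).trans (hg i).symm
    simp only [Hom.restrict_eq_iff] at this
    ext x
    exact Y.eq_of_partition ha fun i => this i x

/-! ### Conditional relations -/

/-- A conditional binary relation. -/
abbrev Rel (X : CondSet.{u, v} A) (Y : CondSet.{u, w} A) := Stable (X.prod Y)

section Rel

variable {X : CondSet.{u, v} A}

/-- The component at `a` of a conditional relation `r` (an order or an equivalence relation)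
as a classical relation on `X_a`. -/
def Rel.le (r : Rel X X) (a : A) (x y : X.obj a) : Prop := (x, y) ∈ r.at a

/-- The strict relation `x <_a y` in `X_a`: `x ≤_a y`, and `bx = by` implies `b = 0`. -/
def Rel.lt (r : Rel X X) (a : A) (x y : X.obj a) : Prop :=
  r.le a x y ∧ ∀ b ≤ a, X.res b x = X.res b y → b = ⊥

/-- Conditional equivalence relations. -/
def Rel.IsEquivalence (r : Rel X X) : Prop := Equivalence (r.le ⊤)

/-- Conditional partial orders. -/
structure Rel.IsPartialOrder (r : Rel X X) : Prop where
  refl : ∀ x, r.le ⊤ x x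
  trans : ∀ x y z, r.le ⊤ x y → r.le ⊤ y z → r.le ⊤ x z
  antisymm : ∀ x y, r.le ⊤ x y → r.le ⊤ y x → x = y

/-- Conditional total orders: for all `x`, `y` there is `(a, b, c) ∈ p(1)` with `ax < ay`,
`by < bx` and `cx = cy`. -/
structure Rel.IsTotalOrder (r : Rel X X) : Prop extends r.IsPartialOrder where
  total : ∀ x y : X.obj ⊤, ∃ a b c : A, IsPartition ⊤ ![a, b, c] ∧
    r.lt a (X.γ a x) (X.γ a y) ∧ r.lt b (X.γ b y) (X.γ b x) ∧ X.γ c x = X.γ c y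

theorem Rel.le_top {r : Rel X X} {x y : X.obj ⊤} : r.le ⊤ x y ↔ (x, y) ∈ r.primal :=
  Stable.mem_at_top r

theorem Rel.lt_top {r : Rel X X} {x y : X.obj ⊤} :
    r.lt ⊤ x y ↔ (x, y) ∈ r.primal ∧ ∀ b, X.γ b x = X.γ b y → b = ⊥ := by
  simp only [Rel.lt, Rel.le_top, res_top, _root_.le_top, true_implies]

theorem Rel.IsEquivalence.at {r : Rel X X} (h : r.IsEquivalence) (a : A) :
    Equivalence (r.le a) where
  refl x := by
    obtain ⟨x, rfl⟩ := X.surjective a x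
    exact ⟨(x, x), Rel.le_top.1 (h.refl x), rfl⟩
  symm := by
    rintro _ _ ⟨⟨x, y⟩, hxy, e⟩
    exact ⟨(y, x), Rel.le_top.1 (h.symm (Rel.le_top.2 hxy)),
      Prod.ext (congrArg Prod.snd e) (congrArg Prod.fst e)⟩
  trans := by
    rintro _ _ _ ⟨⟨x, y⟩, hxy, e⟩ ⟨⟨y', z⟩, hyz, e'⟩
    obtain rfl := (congrArg Prod.fst e).symm
    obtain rfl := (congrArg Prod.snd e').symm
    have e1 : X.γ a y = X.γ a y' := (congrArg Prod.snd e).trans (congrArg Prod.fst e').symm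
    obtain ⟨t, ht, ht'⟩ := X.exists_mix a x y'
    have : (t, y') ∈ r.primal := r.mix a (x := (x, y)) (y := (y', y')) hxy
      (Rel.le_top.1 (h.refl y')) (Prod.ext ht e1.symm) (Prod.ext ht' rfl)
    exact ⟨(t, z), Rel.le_top.1 (h.trans (Rel.le_top.2 this) (Rel.le_top.2 hyz)),
      Prod.ext ht rfl⟩

theorem Rel.le_γ_iff {r : Rel X X} (h : r.IsEquivalence) {a : A} {x y : X.obj ⊤} :
    r.le a (X.γ a x) (X.γ a y) ↔ ∃ z, X.γ a z = X.γ a x ∧ (z, y) ∈ r.primal := by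
  constructor
  · rintro ⟨⟨u, v⟩, huv, e⟩
    obtain ⟨t, ht, ht'⟩ := X.exists_mix a u y
    exact ⟨t, ht.trans (congrArg Prod.fst e), r.mix a (x := (u, v)) (y := (y, y)) huv
      (Rel.le_top.1 (h.refl y)) (Prod.ext ht (congrArg Prod.snd e).symm) (Prod.ext ht' rfl)⟩
  · rintro ⟨z, hz, hzy⟩
    exact ⟨(z, y), hzy, Prod.ext hz rfl⟩

theorem Rel.le_of_le {r : Rel X X} {a b : A} (hab : a ≤ b) {x y : X.obj ⊤}
    (h : r.le b (X.γ b x) (X.γ b y)) : r.le a (X.γ a x) (X.γ a y) := by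
  obtain ⟨⟨u, v⟩, huv, e⟩ := h
  exact ⟨(u, v), huv, (X.prod X).consistency a b hab _ (x, y) e⟩

/-- The setoid of the component at `a` of a conditional equivalence relation. -/
def Rel.setoid {r : Rel X X} (h : r.IsEquivalence) (a : A) : Setoid (X.obj a) :=
  ⟨r.le a, h.at a⟩

/-- The quotient of a conditional set by a conditional equivalence relation. -/
def quotient (X : CondSet.{u, v} A) {r : Rel X X} (h : r.IsEquivalence) : CondSet.{u, v} A where
  obj a := Quotient (Rel.setoid h a)
  γ a := Quotient.map' (s₁ := Rel.setoid h ⊤) (s₂ := Rel.setoid h a) (X.γ a) (fun x y hxy =>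
    ⟨(x, y), Rel.le_top.1 hxy, rfl⟩)
  singleton_bot := by
    obtain ⟨x, hx⟩ := X.singleton_bot
    refine ⟨Quotient.mk'' x, fun y => ?_⟩
    induction y using Quotient.inductionOn' with
    | h y => rw [hx y]
  surjective a y := by
    induction y using Quotient.inductionOn' with
    | h y =>
      obtain ⟨x, rfl⟩ := X.surjective a y
      exact ⟨Quotient.mk'' x, rfl⟩
  identity x := by
    induction x using Quotient.inductionOn' with
    | h x => exact congrArg Quotient.mk'' (X.identity x)
  consistency a b hab x y e := by
    induction x using Quotient.inductionOn' with
    | h x =>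
      induction y using Quotient.inductionOn' with
      | h y => exact Quotient.sound' (Rel.le_of_le hab (Quotient.exact' e))
  stability I a ha x := by
    choose s hs using fun i => Quotient.exists_rep (x i)
    obtain ⟨z, hz, -⟩ := X.stability I a ha s
    refine ⟨Quotient.mk'' z, fun i => ?_, fun y hy => ?_⟩
    · rw [← hs i, ← hz i]; rfl
    · induction y using Quotient.inductionOn' with
      | h y =>
        refine Quotient.sound' (Rel.le_top.2 ?_)
        have : ∀ i, r.le (a i) (X.γ (a i) y) (X.γ (a i) z) := fun i =>
          Quotient.exact' ((hy i).trans ((hs i).symm.trans (congrArg Quotient.mk'' (hz i).symm)))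
        choose p hp hp' using this
        exact r.stable I a ha p hp (y, z) fun i => (hp' i).symm

/-- The class in the quotient of an element of the primal set. -/
def quotient.mk {r : Rel X X} (h : r.IsEquivalence) (x : X.obj ⊤) : (X.quotient h).obj ⊤ :=
  Quotient.mk'' (s₁ := Rel.setoid h ⊤) x

theorem quotient.mk_surjective {r : Rel X X} (h : r.IsEquivalence) :
    Function.Surjective (quotient.mk h) := fun x => Quotient.exists_rep x

theorem quotient.mk_eq {r : Rel X X} (h : r.IsEquivalence) {x y : X.obj ⊤} :
    quotient.mk h x = quotient.mk h y ↔ (x, y) ∈ r.primal :=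
  ⟨fun e => Rel.le_top.1 (Quotient.exact' e), fun e => Quotient.sound' (Rel.le_top.2 e)⟩

theorem quotient.γ_mk_eq {r : Rel X X} (h : r.IsEquivalence) {a : A} {x y : X.obj ⊤} :
    (X.quotient h).γ a (quotient.mk h x) = (X.quotient h).γ a (quotient.mk h y) ↔
      ∃ z, X.γ a z = X.γ a x ∧ (z, y) ∈ r.primal := by
  rw [← Rel.le_γ_iff h]
  exact ⟨fun e => Quotient.exact' e, fun e => Quotient.sound' e⟩

/-- The conditional operation `[x] * [y] := [x * y]` on a quotient. -/
def quotient.map₂ {r : Rel X X} (h : r.IsEquivalence) (f : Hom (X.prod X) X)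
    (hf : ∀ x x' y y', (x, x') ∈ r.primal → (y, y') ∈ r.primal →
      (f.toFun (x, y), f.toFun (x', y')) ∈ r.primal) :
    Hom ((X.quotient h).prod (X.quotient h)) (X.quotient h) :=
  Hom.mk' (fun p => Quotient.map₂ (sa := Rel.setoid h ⊤) (sb := Rel.setoid h ⊤)
      (sc := Rel.setoid h ⊤) (fun x y => f.toFun (x, y))
      (fun _ _ h1 _ _ h2 => Rel.le_top.2 (hf _ _ _ _ (Rel.le_top.1 h1) (Rel.le_top.1 h2)))
      p.1 p.2) (by
    rintro b ⟨p, q⟩ ⟨p', q'⟩ e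
    obtain ⟨x, rfl⟩ := quotient.mk_surjective h p
    obtain ⟨y, rfl⟩ := quotient.mk_surjective h q
    obtain ⟨x', rfl⟩ := quotient.mk_surjective h p'
    obtain ⟨y', rfl⟩ := quotient.mk_surjective h q'
    obtain ⟨s, hs, hs'⟩ := (quotient.γ_mk_eq h).1 (congrArg Prod.fst e)
    obtain ⟨t, ht, ht'⟩ := (quotient.γ_mk_eq h).1 (congrArg Prod.snd e)
    refine (quotient.γ_mk_eq h (x := f.toFun (x, y)) (y := f.toFun (x', y'))).2
      ⟨f.toFun (s, t), f.γ_eq (Prod.ext hs ht), hf _ _ _ _ hs' ht'⟩)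

end Rel
end CondSet

/-! ### Conditional sets generated by classical sets -/

namespace CondSet

variable {A : Type u} [CompleteBooleanAlgebra A] {E F G : Type w}

/-- The conditional set generated by a non-empty set `E`. A formal sum `∑ aᵢ xᵢ` with
`(aᵢ) ∈ p(a)` and `xᵢ ∈ E` is identified with the function `z ↦ ⨆ {aᵢ | xᵢ = z}`, which is what
decides when two such sums are equal; restriction to `a` sends `∑ aᵢ xᵢ` to `∑ (a ⊓ aᵢ) xᵢ`. -/
noncomputable def gen (A : Type u) [CompleteBooleanAlgebra A] (E : Type w) [Nonempty E] :
    CondSet.{u, max u w} A where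
  obj a := {x : E → A // IsPartition a x}
  γ a x := ⟨fun z => a ⊓ x.1 z, by
    refine ⟨fun i j hij => ?_, ?_⟩
    · exact le_bot_iff.1 ((inf_le_inf inf_le_right inf_le_right).trans (x.2.1 i j hij).le)
    · rw [← inf_iSup_eq, x.2.2, inf_top_eq]⟩
  singleton_bot := by
    have key : ∀ x : {x : E → A // IsPartition ⊥ x}, ∀ z, x.1 z = ⊥ := fun x z =>
      le_bot_iff.1 ((le_iSup x.1 z).trans x.2.2.le)
    exact ⟨⟨fun _ => ⊥, by simp [IsPartition]⟩, fun y => Subtype.ext (funext fun z => key y z)⟩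
  surjective a y := by
    classical
    obtain ⟨e⟩ := ‹Nonempty E›
    have hle : ∀ z, y.1 z ≤ a := fun z => (le_iSup y.1 z).trans y.2.2.le
    have hd : ∀ z, y.1 z ⊓ aᶜ = ⊥ := fun z =>
      le_bot_iff.1 ((inf_le_inf_right _ (hle z)).trans inf_compl_eq_bot.le)
    refine ⟨⟨fun z => y.1 z ⊔ if z = e then aᶜ else ⊥, ?_, ?_⟩, ?_⟩
    · intro i j hij
      rcases eq_or_ne i e with rfl | hi
      · simp [hij.symm, inf_sup_right, y.2.1 i j hij, inf_comm aᶜ, hd]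
      · rcases eq_or_ne j e with rfl | hj
        · simp [hi, inf_sup_left, y.2.1 i j hij, hd]
        · simp [hi, hj, y.2.1 i j hij]
    · rw [iSup_sup_eq, y.2.2, iSup_ite]
      simp
    · refine Subtype.ext (funext fun z => ?_)
      by_cases hz : z = e <;> simp [hz, inf_sup_left, hle]
  identity x := Subtype.ext (funext fun z => top_inf_eq _)
  consistency a b h x y e := by
    refine Subtype.ext (funext fun z => ?_)
    have : b ⊓ x.1 z = b ⊓ y.1 z := congrFun (congrArg Subtype.val e) z
    change a ⊓ x.1 z = a ⊓ y.1 z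
    rw [← inf_eq_left.2 h, inf_assoc, this, inf_assoc]
  stability I a ha x := by
    have hle : ∀ i z, (x i).1 z ≤ a i := fun i z => (le_iSup (x i).1 z).trans (x i).2.2.le
    have hin : ∀ i z, a i ⊓ ⨆ j, (x j).1 z = (x i).1 z := by
      intro i z
      apply le_antisymm
      · rw [inf_iSup_eq]
        refine iSup_le fun j => ?_
        rcases eq_or_ne i j with rfl | hij
        · exact inf_le_right
        · exact (inf_le_inf_left _ (hle j z)).trans ((ha.1 i j hij).le.trans bot_le)
      · exact le_inf (hle i z) (le_iSup (fun j => (x j).1 z) i)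
    refine ⟨⟨fun z => ⨆ i, (x i).1 z, ?_, ?_⟩, fun i => Subtype.ext (funext (hin i)), ?_⟩
    · intro z z' hz
      simp only [iSup_inf_eq]
      refine le_bot_iff.1 (iSup_le fun i => ?_)
      calc (x i).1 z ⊓ ⨆ j, (x j).1 z' ≤ (x i).1 z ⊓ (a i ⊓ ⨆ j, (x j).1 z') :=
            le_inf inf_le_left (inf_le_inf_right _ (hle i z))
        _ = ⊥ := by rw [hin, (x i).2.1 z z' hz]
    · rw [iSup_comm]
      simp only [fun i => (x i).2.2, ha.2]
    · intro y hy
      refine Subtype.ext (funext fun z => ?_)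
      have : ∀ i, a i ⊓ y.1 z = (x i).1 z := fun i => congrFun (congrArg Subtype.val (hy i)) z
      change y.1 z = ⨆ i, (x i).1 z
      rw [← iSup_congr this, ← iSup_inf_eq, ha.2, top_inf_eq]

theorem exists_val {x : E → A} (hx : IsPartition ⊤ x) {c : A} (hc : c ≠ ⊥) :
    ∃ d ≤ c, d ≠ ⊥ ∧ ∃ z, d ≤ x z := by
  by_contra h
  push Not at h
  refine hc ?_
  rw [← inf_top_eq c, ← hx.2, inf_iSup_eq]
  refine iSup_eq_bot.2 fun z => ?_
  by_contra hz
  exact h _ inf_le_left hz z inf_le_right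

theorem val_unique {a : A} {x : E → A} (hx : IsPartition a x) {c : A} (hc : c ≠ ⊥) {z z' : E}
    (h : c ≤ x z) (h' : c ≤ x z') : z = z' := by
  by_contra hz
  exact hc (le_bot_iff.1 ((le_inf h h').trans (hx.1 z z' hz).le))

variable [Nonempty E] [Nonempty F] [Nonempty G]

theorem gen_γ_eq {x y : (gen A E).obj ⊤} {a : A} :
    (gen A E).γ a x = (gen A E).γ a y ↔ ∀ c ≤ a, ∀ z, c ≤ x.1 z → c ≤ y.1 z := by
  constructor
  · intro h c hc z hz
    have : a ⊓ x.1 z = a ⊓ y.1 z := congrFun (congrArg Subtype.val h) z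
    exact (le_inf hc hz).trans (this.le.trans inf_le_right)
  · intro h
    refine Subtype.ext (funext fun z => le_antisymm (le_inf inf_le_left ?_)
      (le_inf inf_le_left ?_))
    · exact h _ inf_le_left z inf_le_right
    · by_contra hn
      have hc : (a ⊓ y.1 z) \ x.1 z ≠ ⊥ := fun e => hn (sdiff_eq_bot_iff.1 e)
      obtain ⟨d, hd, hd0, z', hz'⟩ := exists_val x.2 hc
      have hdy : d ≤ y.1 z := hd.trans (sdiff_le.trans inf_le_right)
      have := h d (hd.trans (sdiff_le.trans inf_le_left)) z' hz'
      obtain rfl := val_unique y.2 hd0 hdy this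
      exact hd0 (disjoint_self.1 (Disjoint.mono hz' hd disjoint_sdiff_self_right))

/-- To show that `x` and `y` agree on `a` it suffices that they have a common value on densely
many conditions below `a`. -/
theorem gen_γ_eq_of_dense {x y : (gen A E).obj ⊤} {a : A}
    (h : ∀ c ≤ a, c ≠ ⊥ → ∃ d ≤ c, d ≠ ⊥ ∧ ∃ z, d ≤ x.1 z ∧ d ≤ y.1 z) :
    (gen A E).γ a x = (gen A E).γ a y := by
  rw [gen_γ_eq]
  intro c hc z hz
  by_contra hn
  have hc0 : c \ y.1 z ≠ ⊥ := fun e => hn (sdiff_eq_bot_iff.1 e)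
  obtain ⟨d, hd, hd0, z', hx, hy⟩ := h _ (sdiff_le.trans hc) hc0
  obtain rfl := val_unique x.2 hd0 hx (hd.trans (sdiff_le.trans hz))
  exact hd0 (disjoint_self.1 (Disjoint.mono hy hd disjoint_sdiff_self_right))

/-- The conditional element `1 e` given by an element `e` of the generating set. -/
noncomputable def gen.const (e : E) : (gen A E).obj ⊤ := by
  classical
  exact ⟨fun z => if z = e then ⊤ else ⊥, by
    refine ⟨fun i j hij => ?_, by simp [iSup_ite]⟩
    by_cases hi : i = e
    · simp [hi, (hi ▸ hij).symm]
    · simp [hi]⟩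

theorem gen.le_const (e : E) (c : A) : c ≤ (gen.const (A := A) e).1 e := by simp [gen.const]

/-- The conditional function generated by `f : E × F → G`:
`(∑ aᵢ xᵢ, ∑ bⱼ yⱼ) ↦ ∑ (aᵢ ⊓ bⱼ) f(xᵢ, yⱼ)`. -/
noncomputable def gen.map₂ (A : Type u) [CompleteBooleanAlgebra A] (f : E → F → G) :
    Hom ((gen A E).prod (gen A F)) (gen A G) :=
  Hom.mk' (fun p => ⟨fun z => ⨆ (s : E) (t : F) (_ : f s t = z), p.1.1 s ⊓ p.2.1 t, by
    have key : ∀ c : A, c ≠ ⊥ → ∃ d ≤ c, d ≠ ⊥ ∧ ∃ s t, d ≤ p.1.1 s ∧ d ≤ p.2.1 t := by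
      intro c hc
      obtain ⟨d, hd, hd0, s, hs⟩ := exists_val p.1.2 hc
      obtain ⟨d', hd', hd0', t, ht⟩ := exists_val p.2.2 hd0
      exact ⟨d', hd'.trans hd, hd0', s, t, hd'.trans hs, ht⟩
    refine ⟨fun i j hij => ?_, ?_⟩
    · simp only [inf_iSup_eq, iSup_inf_eq, iSup_eq_bot]
      rintro s t rfl s' t' rfl
      by_contra hc
      obtain rfl := val_unique p.1.2 hc (inf_le_left.trans inf_le_left)
        (inf_le_right.trans inf_le_left)
      obtain rfl := val_unique p.2.2 hc (inf_le_left.trans inf_le_right)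
        (inf_le_right.trans inf_le_right)
      exact hij rfl
    · rw [← compl_eq_bot]
      by_contra hc
      obtain ⟨d, hd, hd0, s, t, hs, ht⟩ := key _ hc
      have : d ≤ ⨆ z, ⨆ (s : E) (t : F) (_ : f s t = z), p.1.1 s ⊓ p.2.1 t :=
        le_iSup_of_le (f s t) (le_iSup_of_le s (le_iSup_of_le t (le_iSup_of_le rfl
          (le_inf hs ht))))
      exact hd0 (disjoint_self.1 (Disjoint.mono this hd disjoint_compl_right))⟩) (by
    rintro b ⟨x, y⟩ ⟨x', y'⟩ e
    have e1 : (gen A E).γ b x = (gen A E).γ b x' := congrArg Prod.fst e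
    have e2 : (gen A F).γ b y = (gen A F).γ b y' := congrArg Prod.snd e
    have h1 : ∀ s, b ⊓ x.1 s = b ⊓ x'.1 s := fun s => congrFun (congrArg Subtype.val e1) s
    have h2 : ∀ t, b ⊓ y.1 t = b ⊓ y'.1 t := fun t => congrFun (congrArg Subtype.val e2) t
    refine Subtype.ext (funext fun z => ?_)
    change b ⊓ (⨆ (s : E) (t : F) (_ : f s t = z), x.1 s ⊓ y.1 t) =
      b ⊓ (⨆ (s : E) (t : F) (_ : f s t = z), x'.1 s ⊓ y'.1 t)
    simp only [inf_iSup_eq]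
    refine iSup_congr fun s => iSup_congr fun t => iSup_congr fun _ => ?_
    rw [inf_inf_distrib_left, h1, h2, ← inf_inf_distrib_left])

theorem gen.le_map₂ (f : E → F → G) {x : (gen A E).obj ⊤} {y : (gen A F).obj ⊤} {c : A} {s : E}
    {t : F} (hs : c ≤ x.1 s) (ht : c ≤ y.1 t) :
    c ≤ ((gen.map₂ A f).toFun (x, y)).1 (f s t) :=
  le_iSup_of_le s (le_iSup_of_le t (le_iSup_of_le rfl (le_inf hs ht)))

/-- The conditional function generated by `f : E → F`: `∑ aᵢ xᵢ ↦ ∑ aᵢ f(xᵢ)`. -/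
noncomputable def gen.map (A : Type u) [CompleteBooleanAlgebra A] (f : E → F) :
    Hom (gen A E) (gen A F) :=
  Hom.mk' (fun x => (gen.map₂ A (fun s _ : E => f s)).toFun (x, x))
    (fun _ _ _ h => (gen.map₂ A (fun s _ : E => f s)).γ_eq (Prod.ext h h))

theorem gen.le_map (f : E → F) {x : (gen A E).obj ⊤} {c : A} {s : E} (hs : c ≤ x.1 s) :
    c ≤ ((gen.map A f).toFun x).1 (f s) := gen.le_map₂ (fun s _ : E => f s) hs hs

/-- The conditional relation generated by a non-empty relation `R`: `∑ aᵢ xᵢ` and `∑ bⱼ yⱼ` are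
related if `R xᵢ yⱼ` whenever `aᵢ ⊓ bⱼ ≠ 0`. -/
def gen.rel (A : Type u) [CompleteBooleanAlgebra A] (R : E → F → Prop) (hR : ∃ s t, R s t) :
    Rel (gen A E) (gen A F) where
  primal := {p | ∀ s t, p.1.1 s ⊓ p.2.1 t ≠ ⊥ → R s t}
  nonempty := by
    obtain ⟨s, t, h⟩ := hR
    refine ⟨(gen.const s, gen.const t), fun s' t' hst => ?_⟩
    obtain rfl := val_unique (gen.const (A := A) s).2 hst inf_le_left (gen.le_const s _)
    obtain rfl := val_unique (gen.const (A := A) t).2 hst inf_le_right (gen.le_const t _)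
    exact h
  stable I a ha p hp q hq := by
    intro s t hst
    obtain ⟨d, hd, hd0, i, hi⟩ := exists_val (x := a) ha hst
    have e1 : (gen A E).γ (a i) q.1 = (gen A E).γ (a i) (p i).1 := congrArg Prod.fst (hq i)
    have e2 : (gen A F).γ (a i) q.2 = (gen A F).γ (a i) (p i).2 := congrArg Prod.snd (hq i)
    refine hp i s t fun h0 => hd0 (le_bot_iff.1 (le_trans (le_inf ?_ ?_) h0.le))
    · exact gen_γ_eq.1 e1 d hi s (hd.trans inf_le_left)
    · exact gen_γ_eq.1 e2 d hi t (hd.trans inf_le_right)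

theorem gen.mem_rel {R : E → F → Prop} {hR : ∃ s t, R s t} {x : (gen A E).obj ⊤}
    {y : (gen A F).obj ⊤} : (x, y) ∈ (gen.rel A R hR).primal ↔
      ∀ c : A, c ≠ ⊥ → ∃ d ≤ c, d ≠ ⊥ ∧ ∃ s t, d ≤ x.1 s ∧ d ≤ y.1 t ∧ R s t := by
  constructor
  · intro h c hc
    obtain ⟨d, hd, hd0, s, hs⟩ := exists_val x.2 hc
    obtain ⟨d', hd', hd0', t, ht⟩ := exists_val y.2 hd0
    exact ⟨d', hd'.trans hd, hd0', s, t, hd'.trans hs, ht,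
      h s t fun h0 => hd0' (le_bot_iff.1 ((le_inf (hd'.trans hs) ht).trans h0.le))⟩
  · intro h s t hst
    obtain ⟨d, hd, hd0, s', t', hs, ht, hR⟩ := h _ hst
    obtain rfl := val_unique x.2 hd0 hs (hd.trans inf_le_left)
    obtain rfl := val_unique y.2 hd0 ht (hd.trans inf_le_right)
    exact hR

theorem gen.rel_val {R : E → F → Prop} {hR : ∃ s t, R s t} {x : (gen A E).obj ⊤}
    {y : (gen A F).obj ⊤} (h : (x, y) ∈ (gen.rel A R hR).primal) {c : A} (hc : c ≠ ⊥) {s : E}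
    {t : F} (hs : c ≤ x.1 s) (ht : c ≤ y.1 t) : R s t :=
  h s t fun h0 => hc (le_bot_iff.1 ((le_inf hs ht).trans h0.le))

end CondSet

/-! ### Conditionally ordered fields -/

open CondSet

/-- A conditional set with two conditional operations and a conditional relation. -/
structure CondOrderedStr (A : Type u) [CompleteBooleanAlgebra A] where
  carrier : CondSet.{u, v} A
  add : Hom (carrier.prod carrier) carrier
  mul : Hom (carrier.prod carrier) carrier
  le : Rel carrier carrier

namespace CondOrderedStr

variable {A : Type u} [CompleteBooleanAlgebra A]

/-- `x ∈ X^*`, the conditional complement of the conditional singleton `{z}`: `x` differs from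
`z` on every nonzero condition. -/
def Apart {X : CondSet.{u, v} A} (x z : X.obj ⊤) : Prop := ∀ a, X.γ a x = X.γ a z → a = ⊥

/-- A conditionally ordered field: a conditional total order such that the primal set is a
(commutative) ring with `1` conditionally different from `0`, every element of
`X^* = {0}^⊏` has an inverse in `X^*`, and the order is compatible with the operations. -/
structure IsOrderedField (S : CondOrderedStr.{u, v} A) : Prop where
  total : S.le.IsTotalOrder
  field : ∃ _ : CommRing (S.carrier.obj ⊤),
    (∀ x y, S.add.toFun (x, y) = x + y) ∧
    (∀ x y, S.mul.toFun (x, y) = x * y) ∧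
    Apart (1 : S.carrier.obj ⊤) 0 ∧
    (∀ x : S.carrier.obj ⊤, Apart x 0 → ∃ y, Apart y 0 ∧ x * y = 1 ∧ y * x = 1) ∧
    (∀ x y z : S.carrier.obj ⊤, S.le.lt ⊤ x y → S.le.lt ⊤ (x + z) (y + z)) ∧
    (∀ x y : S.carrier.obj ⊤, S.le.lt ⊤ 0 x → S.le.lt ⊤ 0 y → S.le.lt ⊤ 0 (x * y))

/-- The operations, and the order, of `S` restrict to the conditional subset `K`. -/
structure IsSubstructure (S : CondOrderedStr.{u, v} A) (K : S.carrier.Stable) : Prop where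
  add_mem : ∀ x ∈ K.primal, ∀ y ∈ K.primal, S.add.toFun (x, y) ∈ K.primal
  mul_mem : ∀ x ∈ K.primal, ∀ y ∈ K.primal, S.mul.toFun (x, y) ∈ K.primal
  le_nonempty : ∃ x ∈ K.primal, ∃ y ∈ K.primal, (x, y) ∈ S.le.primal

/-- Restriction of a conditional operation to a conditional subset closed under it. -/
def restrictOp {X : CondSet.{u, v} A} (K : X.Stable) (f : Hom (X.prod X) X)
    (hf : ∀ x ∈ K.primal, ∀ y ∈ K.primal, f.toFun (x, y) ∈ K.primal) :
    Hom (K.toCondSet.prod K.toCondSet) K.toCondSet :=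
  Hom.mk' (fun p => ⟨f.toFun (p.1.1, p.2.1),
      K.mem_at_top.2 (hf _ (K.mem_at_top.1 p.1.2) _ (K.mem_at_top.1 p.2.2))⟩)
    (fun _ _ _ e => Subtype.ext (f.γ_eq (Prod.ext
      (congrArg (fun q => q.1.1) e) (congrArg (fun q => q.2.1) e))))

/-- The structure induced on a conditional subset. -/
def induced (S : CondOrderedStr.{u, v} A) (K : S.carrier.Stable) (h : S.IsSubstructure K) :
    CondOrderedStr.{u, v} A where
  carrier := K.toCondSet
  add := restrictOp K S.add h.add_mem
  mul := restrictOp K S.mul h.mul_mem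
  le :=
    { primal := {p | (p.1.1, p.2.1) ∈ S.le.primal}
      nonempty := by
        obtain ⟨x, hx, y, hy, hxy⟩ := h.le_nonempty
        exact ⟨(⟨x, K.mem_at_top.2 hx⟩, ⟨y, K.mem_at_top.2 hy⟩), hxy⟩
      stable := fun I a ha p hp q hq => S.le.stable I a ha (fun i => ((p i).1.1, (p i).2.1)) hp _
        fun i => Prod.ext (congrArg (fun q => q.1.1) (hq i)) (congrArg (fun q => q.2.1) (hq i)) }

/-- Conditional bijections respecting the operations and the order. -/
structure IsIso {S T : CondOrderedStr.{u, v} A} (f : Hom S.carrier T.carrier) : Prop where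
  bijective : f.Bijective
  map_add : ∀ x y, f.toFun (S.add.toFun (x, y)) = T.add.toFun (f.toFun x, f.toFun y)
  map_mul : ∀ x y, f.toFun (S.mul.toFun (x, y)) = T.mul.toFun (f.toFun x, f.toFun y)
  map_le : ∀ x y, (f.toFun x, f.toFun y) ∈ T.le.primal ↔ (x, y) ∈ S.le.primal

end CondOrderedStr

/-! ### The conditional rational and the conditional real numbers -/

section Real

/-- The conditional natural numbers. -/
noncomputable abbrev condNat (A : Type u) [CompleteBooleanAlgebra A] : CondSet.{u, u} A := gen A ℕ

/-- The conditional rational numbers, with the generated operations and the generated order. -/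
noncomputable def condRat (A : Type u) [CompleteBooleanAlgebra A] : CondOrderedStr.{u, u} A where
  carrier := gen A ℚ
  add := gen.map₂ A fun x y : ℚ => x + y
  mul := gen.map₂ A fun x y : ℚ => x * y
  le := gen.rel A (fun x y : ℚ => x ≤ y) ⟨0, 0, le_rfl⟩

variable {A : Type u} [CompleteBooleanAlgebra A]

namespace CondNat

/-- `m ≤ n` for conditional natural numbers. -/
def le (m n : (condNat A).obj ⊤) : Prop :=
  (gen.rel A (fun m n : ℕ => m ≤ n) ⟨0, 0, le_rfl⟩).le ⊤ m n

/-- The conditional maximum of two conditional natural numbers. -/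
noncomputable def max (m n : (condNat A).obj ⊤) : (condNat A).obj ⊤ :=
  (gen.map₂ A (fun m n : ℕ => Max.max m n)).toFun (m, n)

theorem le_iff {m n : (condNat A).obj ⊤} : le m n ↔
    ∀ c : A, c ≠ ⊥ → ∃ d ≤ c, d ≠ ⊥ ∧ ∃ s t : ℕ, d ≤ m.1 s ∧ d ≤ n.1 t ∧ s ≤ t :=
  Rel.le_top.trans gen.mem_rel

theorem le_val {m n : (condNat A).obj ⊤} (h : le m n) {c : A} (hc : c ≠ ⊥) {s t : ℕ}
    (hs : c ≤ m.1 s) (ht : c ≤ n.1 t) : s ≤ t :=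
  gen.rel_val (Rel.le_top.1 h) hc hs ht

theorem exists_vals {m n : (condNat A).obj ⊤} {c : A} (hc : c ≠ ⊥) :
    ∃ d ≤ c, d ≠ ⊥ ∧ ∃ s t : ℕ, d ≤ m.1 s ∧ d ≤ n.1 t := by
  obtain ⟨d, hd, hd0, s, hs⟩ := exists_val m.2 hc
  obtain ⟨d', hd', hd0', t, ht⟩ := exists_val n.2 hd0
  exact ⟨d', hd'.trans hd, hd0', s, t, hd'.trans hs, ht⟩

theorem le_max_left (m n : (condNat A).obj ⊤) : le m (max m n) := le_iff.2 fun c hc => by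
  obtain ⟨d, hd, hd0, s, t, hs, ht⟩ := exists_vals (m := m) (n := n) hc
  exact ⟨d, hd, hd0, s, _, hs, gen.le_map₂ _ hs ht, _root_.le_max_left _ _⟩

theorem le_max_right (m n : (condNat A).obj ⊤) : le n (max m n) := le_iff.2 fun c hc => by
  obtain ⟨d, hd, hd0, s, t, hs, ht⟩ := exists_vals (m := m) (n := n) hc
  exact ⟨d, hd, hd0, t, _, ht, gen.le_map₂ _ hs ht, _root_.le_max_right _ _⟩

theorem le_trans {k m n : (condNat A).obj ⊤} (h : le k m) (h' : le m n) : le k n :=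
  le_iff.2 fun c hc => by
    obtain ⟨d, hd, hd0, s, t, hs, ht, hst⟩ := le_iff.1 h c hc
    obtain ⟨e, he, he0, r, hr⟩ := exists_val n.2 hd0
    exact ⟨e, he.trans hd, he0, s, r, he.trans hs, hr, hst.trans (le_val h' he0 (he.trans ht) hr)⟩

theorem γ_max {m n k : (condNat A).obj ⊤} {a : A} (h : le m n)
    (hk : (condNat A).γ a m = (condNat A).γ a k) :
    (condNat A).γ a n = (condNat A).γ a (max n k) :=
  gen_γ_eq_of_dense fun c hc hc0 => by
    obtain ⟨d, hd, hd0, s, t, hs, ht⟩ := exists_vals (m := m) (n := n) hc0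
    refine ⟨d, hd, hd0, t, ht, ?_⟩
    have := gen.le_map₂ Max.max ht (gen_γ_eq.1 hk d (hd.trans hc) s hs)
    rwa [max_eq_left (le_val h hd0 hs ht)] at this

end CondNat

namespace CondRat

/-- `x < y` for conditional rational numbers. -/
def lt (x y : (gen A ℚ).obj ⊤) : Prop := (condRat A).le.lt ⊤ x y

/-- `|x - y|` for conditional rational numbers. -/
noncomputable def dist (x y : (gen A ℚ).obj ⊤) : (gen A ℚ).obj ⊤ :=
  (gen.map A (fun x : ℚ => |x|)).toFun ((gen.map₂ A fun x y : ℚ => x - y).toFun (x, y))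

theorem exists_vals (x y : (gen A ℚ).obj ⊤) {c : A} (hc : c ≠ ⊥) :
    ∃ d ≤ c, d ≠ ⊥ ∧ ∃ s t : ℚ, d ≤ x.1 s ∧ d ≤ y.1 t := by
  obtain ⟨d, hd, hd0, s, hs⟩ := exists_val x.2 hc
  obtain ⟨d', hd', hd0', t, ht⟩ := exists_val y.2 hd0
  exact ⟨d', hd'.trans hd, hd0', s, t, hd'.trans hs, ht⟩

theorem lt_val {x y : (gen A ℚ).obj ⊤} (h : lt x y) {c : A} (hc : c ≠ ⊥) {s t : ℚ}
    (hs : c ≤ x.1 s) (ht : c ≤ y.1 t) : s < t := by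
  obtain ⟨h1, h2⟩ := Rel.lt_top.1 h
  refine lt_of_le_of_ne (gen.rel_val (hR := ⟨0, 0, le_rfl⟩) h1 hc hs ht) ?_
  rintro rfl
  exact hc (h2 c (gen_γ_eq_of_dense fun d hd hd0 => ⟨d, le_rfl, hd0, s, hd.trans hs, hd.trans ht⟩))

theorem lt_iff {x y : (gen A ℚ).obj ⊤} : lt x y ↔
    ∀ c : A, c ≠ ⊥ → ∃ d ≤ c, d ≠ ⊥ ∧ ∃ s t : ℚ, d ≤ x.1 s ∧ d ≤ y.1 t ∧ s < t := by
  constructor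
  · intro h c hc
    obtain ⟨d, hd, hd0, s, t, hs, ht⟩ := exists_vals x y hc
    exact ⟨d, hd, hd0, s, t, hs, ht, lt_val h hd0 hs ht⟩
  · intro h
    refine Rel.lt_top.2 ⟨(gen.mem_rel (hR := ⟨0, 0, le_rfl⟩)).2 fun c hc => ?_, fun b hb => ?_⟩
    · obtain ⟨d, hd, hd0, s, t, hs, ht, hst⟩ := h c hc
      exact ⟨d, hd, hd0, s, t, hs, ht, hst.le⟩
    · by_contra hb0
      obtain ⟨d, hd, hd0, s, t, hs, ht, hst⟩ := h b hb0
      exact hst.ne (val_unique y.2 hd0 (gen_γ_eq.1 hb d hd s hs) ht)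

theorem le_dist {x y : (gen A ℚ).obj ⊤} {c : A} {s t : ℚ} (hs : c ≤ x.1 s) (ht : c ≤ y.1 t) :
    c ≤ (dist x y).1 |s - t| := gen.le_map _ (gen.le_map₂ _ hs ht)

theorem dist_γ {a : A} {x y x' y' : (gen A ℚ).obj ⊤} (hx : (gen A ℚ).γ a x = (gen A ℚ).γ a x')
    (hy : (gen A ℚ).γ a y = (gen A ℚ).γ a y') :
    (gen A ℚ).γ a (dist x y) = (gen A ℚ).γ a (dist x' y') :=
  Fun.γ_eq _ (Fun.γ_eq _ (Prod.ext hx hy))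

end CondRat

open CondRat CondOrderedStr

/-- The conditional set of conditional sequences in the conditional rational numbers. -/
noncomputable abbrev condSeq (A : Type u) [CompleteBooleanAlgebra A] : CondSet.{u, u} A :=
  maps (condNat A) (gen A ℚ)

/-- Conditional Cauchy sequences of conditional rational numbers. -/
def IsCondCauchy (q : Hom (condNat A) (gen A ℚ)) : Prop :=
  ∀ ε, lt (gen.const 0) ε → ∃ n₀, ∀ m n, CondNat.le n₀ m → CondNat.le n₀ n →
    lt (dist (q.toFun n) (q.toFun m)) ε

/-- Conditional convergence of a sequence in the conditional Euclidean topology, which has the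
conditional balls `{y | |y - x| < ε}` as a base. -/
def CondTendsto (q : Hom (condNat A) (gen A ℚ)) (x : (gen A ℚ).obj ⊤) : Prop :=
  ∀ ε, lt (gen.const 0) ε → ∃ n₀, ∀ n, CondNat.le n₀ n → lt (dist (q.toFun n) x) ε

/-- Eventual strict inequalities glue along partitions. -/
theorem glue_eventually {I : Type u} {a : I → A} (ha : IsPartition ⊤ a)
    (G H : (condNat A).obj ⊤ → (condNat A).obj ⊤ → (gen A ℚ).obj ⊤)
    (G' H' : I → (condNat A).obj ⊤ → (condNat A).obj ⊤ → (gen A ℚ).obj ⊤)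
    (hG : ∀ i m n m' n', (condNat A).γ (a i) m = (condNat A).γ (a i) m' →
      (condNat A).γ (a i) n = (condNat A).γ (a i) n' →
      (gen A ℚ).γ (a i) (G m n) = (gen A ℚ).γ (a i) (G' i m' n'))
    (hH : ∀ i m n m' n', (condNat A).γ (a i) m = (condNat A).γ (a i) m' →
      (condNat A).γ (a i) n = (condNat A).γ (a i) n' →
      (gen A ℚ).γ (a i) (H m n) = (gen A ℚ).γ (a i) (H' i m' n'))
    (h : ∀ i, ∃ n₀, ∀ m n, CondNat.le n₀ m → CondNat.le n₀ n → lt (G' i m n) (H' i m n)) :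
    ∃ n₀, ∀ m n, CondNat.le n₀ m → CondNat.le n₀ n → lt (G m n) (H m n) := by
  choose k hk using h
  obtain ⟨n₀, hn₀, -⟩ := (condNat A).stability I a ha (fun i => (condNat A).γ (a i) (k i))
  refine ⟨n₀, fun m n hm hn => lt_iff.2 fun c hc => ?_⟩
  obtain ⟨d, hd, hd0, i, hi⟩ := exists_val (x := a) ha hc
  have h1 := CondNat.γ_max hm (hn₀ i)
  have h2 := CondNat.γ_max hn (hn₀ i)
  have h3 := hk i _ _ (CondNat.le_max_right m (k i)) (CondNat.le_max_right n (k i))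
  obtain ⟨e, he, he0, s, t, hs, ht⟩ := exists_vals (G m n) (H m n) hd0
  exact ⟨e, he.trans hd, he0, s, t, hs, ht, lt_val h3 he0
    (gen_γ_eq.1 (hG i _ _ _ _ h1 h2) e (he.trans hi) s hs)
    (gen_γ_eq.1 (hH i _ _ _ _ h1 h2) e (he.trans hi) t ht)⟩

theorem condSeq_γ {q p : Hom (condNat A) (gen A ℚ)} {a : A}
    (h : (condSeq A).γ a q = (condSeq A).γ a p) {m n : (condNat A).obj ⊤}
    (hmn : (condNat A).γ a m = (condNat A).γ a n) :
    (gen A ℚ).γ a (q.toFun m) = (gen A ℚ).γ a (p.toFun n) :=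
  (Hom.restrict_eq_iff.1 h m).trans (p.γ_eq hmn)

/-- The conditional set of conditional Cauchy sequences, as a conditional subset of the conditional
set of all conditional sequences. -/
noncomputable def condCauchy (A : Type u) [CompleteBooleanAlgebra A] : (condSeq A).Stable where
  primal := {q : Hom (condNat A) (gen A ℚ) | IsCondCauchy q}
  nonempty := by
    refine ⟨Hom.mk' (fun _ => gen.const 0) (fun _ _ _ _ => rfl), fun ε hε => ⟨gen.const 0,
      fun m n _ _ => lt_iff.2 fun c hc => ?_⟩⟩
    obtain ⟨d, hd, hd0, s, hs⟩ := exists_val ε.2 hc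
    have h0 := gen.le_const (0 : ℚ) d
    exact ⟨d, hd, hd0, _, s, le_dist h0 h0, hs, by simpa using lt_val hε hd0 h0 hs⟩
  stable I a ha s hs q hq ε hε := by
    refine glue_eventually ha (fun m n => dist (q.toFun n) (q.toFun m)) (fun _ _ => ε)
      (fun i m n => dist ((s i).toFun n) ((s i).toFun m)) (fun _ _ _ => ε)
      (fun i m n m' n' hm hn => dist_γ (condSeq_γ (hq i) hn) (condSeq_γ (hq i) hm))
      (fun _ _ _ _ _ _ _ => rfl) (fun i => hs i ε hε)

/-- Pointwise operations on conditional sequences. -/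
noncomputable def seqOp (f : Hom ((gen A ℚ).prod (gen A ℚ)) (gen A ℚ)) :
    Hom ((condSeq A).prod (condSeq A)) (condSeq A) :=
  Hom.mk' (fun p => Hom.mk' (fun n => f.toFun (p.1.toFun n, p.2.toFun n))
      (fun _ _ _ h => f.γ_eq (Prod.ext (p.1.γ_eq h) (p.2.γ_eq h))))
    (fun _ _ _ h => Hom.restrict_eq_iff.2 fun _ => f.γ_eq (Prod.ext
      (condSeq_γ (congrArg Prod.fst h) rfl) (condSeq_γ (congrArg Prod.snd h) rfl)))

/-- For `ε > 0` the conditional rational number `δ = ε / (2 (|x| + |y| + 1))` is positive. -/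
theorem exists_delta {ε : (gen A ℚ).obj ⊤} (hε : lt (gen.const 0) ε) (x y : (gen A ℚ).obj ⊤) :
    ∃ δ, lt (gen.const 0) δ ∧ ∀ c : A, ∀ e u v : ℚ, c ≤ ε.1 e → c ≤ x.1 u → c ≤ y.1 v →
      c ≤ δ.1 (e / (2 * (|u| + |v| + 1))) := by
  have key : ∀ c : A, ∀ e u v : ℚ, c ≤ ε.1 e → c ≤ x.1 u → c ≤ y.1 v →
      c ≤ ((gen.map₂ A fun e m : ℚ => e / (2 * (m + 1))).toFun
        (ε, (gen.map₂ A fun u v : ℚ => |u| + |v|).toFun (x, y))).1 (e / (2 * (|u| + |v| + 1))) :=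
    fun c e u v he hu hv => gen.le_map₂ (fun e m : ℚ => e / (2 * (m + 1))) he
      (gen.le_map₂ (fun u v : ℚ => |u| + |v|) hu hv)
  refine ⟨_, lt_iff.2 fun c hc => ?_, key⟩
  obtain ⟨d, hd, hd0, u, v, hu, hv⟩ := exists_vals x y hc
  obtain ⟨d', hd', hd0', e, he⟩ := exists_val ε.2 hd0
  refine ⟨d', hd'.trans hd, hd0', 0, _, gen.le_const 0 d',
    key d' e u v he (hd'.trans hu) (hd'.trans hv), ?_⟩
  have := lt_val hε hd0' (gen.le_const 0 d') he
  positivity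

theorem abs_mul_sub_lt {a b a' b' u v e : ℚ} (h1 : |a - u| < 1) (h2 : |b' - v| < 1)
    (h3 : |a - a'| < e / (2 * (|u| + |v| + 1))) (h4 : |b - b'| < e / (2 * (|u| + |v| + 1))) :
    |a * b - a' * b'| < e := by
  set M := |u| + |v| + 1 with hM
  have hu := abs_nonneg u
  have hv := abs_nonneg v
  have hM0 : 0 < M := by positivity
  have ha : |a| ≤ M := by
    have := abs_sub_abs_le_abs_sub a u
    linarith
  have hb : |b'| ≤ M := by
    have := abs_sub_abs_le_abs_sub b' v
    linarith
  have e1 : a * b - a' * b' = a * (b - b') + b' * (a - a') := by ring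
  have h5 : |a| * |b - b'| ≤ M * |b - b'| := mul_le_mul_of_nonneg_right ha (abs_nonneg _)
  have h6 : |b'| * |a - a'| ≤ M * |a - a'| := mul_le_mul_of_nonneg_right hb (abs_nonneg _)
  have h7 : M * |b - b'| < M * (e / (2 * M)) := mul_lt_mul_of_pos_left h4 hM0
  have h8 : M * |a - a'| < M * (e / (2 * M)) := mul_lt_mul_of_pos_left h3 hM0
  have h9 : M * (e / (2 * M)) = e / 2 := by field_simp
  rw [e1]
  calc _ ≤ |a * (b - b')| + |b' * (a - a')| := abs_add_le _ _
    _ = |a| * |b - b'| + |b'| * |a - a'| := by rw [abs_mul, abs_mul]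
    _ < e := by linarith

theorem abs_add_sub_lt {a b a' b' u v e : ℚ} (h3 : |a - a'| < e / (2 * (|u| + |v| + 1)))
    (h4 : |b - b'| < e / (2 * (|u| + |v| + 1))) : |a + b - (a' + b')| < e := by
  have he : 0 < e / (2 * (|u| + |v| + 1)) := (abs_nonneg _).trans_lt h3
  have h0 : 0 < 2 * (|u| + |v| + 1) := by positivity
  have h1 : 0 < e := by
    rcases div_pos_iff.1 he with h | h
    · exact h.1
    · exact absurd h.2 (not_lt.2 h0.le)
  have h2 : e / (2 * (|u| + |v| + 1)) ≤ e / 2 := by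
    apply div_le_div_of_nonneg_left h1.le (by norm_num)
    have := abs_nonneg u
    have := abs_nonneg v
    linarith
  have e1 : a + b - (a' + b') = (a - a') + (b - b') := by ring
  rw [e1]
  exact (abs_add_le _ _).trans_lt (by linarith)

theorem lt_const_one : lt (gen.const (A := A) 0) (gen.const 1) :=
  lt_iff.2 fun c hc => ⟨c, le_rfl, hc, 0, 1, gen.le_const 0 c, gen.le_const 1 c, one_pos⟩

/-- A quantitative local uniform continuity, satisfied by addition and multiplication; it makes the
induced operation on classes of Cauchy sequences well defined. -/
def IsGoodOp (f : ℚ → ℚ → ℚ) : Prop := ∀ a b a' b' u v e : ℚ, |a - u| < 1 → |b' - v| < 1 →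
  |a - a'| < e / (2 * (|u| + |v| + 1)) → |b - b'| < e / (2 * (|u| + |v| + 1)) →
  |f a b - f a' b'| < e

theorem dist_val {x y ε : (gen A ℚ).obj ⊤} (h : lt (dist x y) ε) {c : A} (hc : c ≠ ⊥)
    {s t e : ℚ} (hs : c ≤ x.1 s) (ht : c ≤ y.1 t) (he : c ≤ ε.1 e) : |s - t| < e :=
  lt_val h hc (le_dist hs ht) he

/-- The main estimate for pointwise operations. -/
theorem lt_of_isGoodOp {f : ℚ → ℚ → ℚ} (hf : IsGoodOp f) {ε δ x y x' y' x₀ y₀ : (gen A ℚ).obj ⊤}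
    (hδ : ∀ c : A, ∀ e u v : ℚ, c ≤ ε.1 e → c ≤ x₀.1 u → c ≤ y₀.1 v →
      c ≤ δ.1 (e / (2 * (|u| + |v| + 1))))
    (h1 : lt (dist x x₀) (gen.const 1)) (h2 : lt (dist y' y₀) (gen.const 1))
    (h3 : lt (dist x x') δ) (h4 : lt (dist y y') δ) :
    lt (dist ((gen.map₂ A f).toFun (x, y)) ((gen.map₂ A f).toFun (x', y'))) ε := by
  refine lt_iff.2 fun c hc => ?_
  obtain ⟨d, hd, hd0, a, b, ha, hb⟩ := exists_vals x y hc
  obtain ⟨d', hd', hd0', a', b', ha', hb'⟩ := exists_vals x' y' hd0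
  obtain ⟨d₂, hd₂, hd₂0, u, v, hu, hv⟩ := exists_vals x₀ y₀ hd0'
  obtain ⟨d₃, hd₃, hd₃0, e, he⟩ := exists_val ε.2 hd₂0
  replace hu := hd₃.trans hu
  replace hv := hd₃.trans hv
  replace ha' := (hd₃.trans hd₂).trans ha'
  replace hb' := (hd₃.trans hd₂).trans hb'
  replace ha := ((hd₃.trans hd₂).trans hd').trans ha
  replace hb := ((hd₃.trans hd₂).trans hd').trans hb
  have hδ' := hδ d₃ e u v he hu hv
  exact ⟨d₃, ((hd₃.trans hd₂).trans hd').trans hd, hd₃0, _, e,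
    le_dist (gen.le_map₂ f ha hb) (gen.le_map₂ f ha' hb'), he,
    hf a b a' b' u v e (dist_val h1 hd₃0 ha hu (gen.le_const 1 _))
      (dist_val h2 hd₃0 hb' hv (gen.le_const 1 _)) (dist_val h3 hd₃0 ha ha' hδ')
      (dist_val h4 hd₃0 hb hb' hδ')⟩

theorem IsCondCauchy.op {f : ℚ → ℚ → ℚ} (hf : IsGoodOp f) {q p : Hom (condNat A) (gen A ℚ)}
    (hq : IsCondCauchy q) (hp : IsCondCauchy p) :
    IsCondCauchy ((seqOp (gen.map₂ A f)).toFun (q, p)) := by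
  intro ε hε
  obtain ⟨k, hk⟩ := hq _ lt_const_one
  obtain ⟨l, hl⟩ := hp _ lt_const_one
  obtain ⟨δ, hδ0, hδ⟩ := exists_delta hε (q.toFun k) (p.toFun l)
  obtain ⟨k', hk'⟩ := hq δ hδ0
  obtain ⟨l', hl'⟩ := hp δ hδ0
  have hkk : CondNat.le k k := CondNat.le_iff.2 fun c hc => by
    obtain ⟨d, hd, hd0, s, hs⟩ := exists_val k.2 hc
    exact ⟨d, hd, hd0, s, s, hs, hs, le_rfl⟩
  have hll : CondNat.le l l := CondNat.le_iff.2 fun c hc => by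
    obtain ⟨d, hd, hd0, s, hs⟩ := exists_val l.2 hc
    exact ⟨d, hd, hd0, s, s, hs, hs, le_rfl⟩
  refine ⟨CondNat.max (CondNat.max k l) (CondNat.max k' l'), fun m n hm hn => ?_⟩
  have m1 := CondNat.le_trans (CondNat.le_max_left _ _) hm
  have n1 := CondNat.le_trans (CondNat.le_max_left _ _) hn
  have m2 := CondNat.le_trans (CondNat.le_max_right _ _) hm
  have n2 := CondNat.le_trans (CondNat.le_max_right _ _) hn
  exact lt_of_isGoodOp hf hδ
    (hk k n hkk (CondNat.le_trans (CondNat.le_max_left _ _) n1))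
    (hl l m hll (CondNat.le_trans (CondNat.le_max_right _ _) m1))
    (hk' m n (CondNat.le_trans (CondNat.le_max_left _ _) m2)
      (CondNat.le_trans (CondNat.le_max_left _ _) n2))
    (hl' m n (CondNat.le_trans (CondNat.le_max_right _ _) m2)
      (CondNat.le_trans (CondNat.le_max_right _ _) n2))

theorem isGoodOp_add : IsGoodOp (fun x y => x + y) :=
  fun _ _ _ _ _ _ _ _ _ h3 h4 => abs_add_sub_lt h3 h4

theorem isGoodOp_mul : IsGoodOp (fun x y => x * y) :=
  fun _ _ _ _ _ _ _ h1 h2 h3 h4 => abs_mul_sub_lt h1 h2 h3 h4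

/-- `(qₙ) ∼ (pₙ)`, i.e. `(qₙ - pₙ) → 0`. -/
def CondEquiv (q p : Hom (condNat A) (gen A ℚ)) : Prop :=
  CondTendsto ((seqOp (gen.map₂ A fun x y : ℚ => x - y)).toFun (q, p)) (gen.const 0)

theorem dist_sub_zero (x y : (gen A ℚ).obj ⊤) :
    dist ((gen.map₂ A fun x y : ℚ => x - y).toFun (x, y)) (gen.const 0) = dist x y := by
  have : ∀ z : (gen A ℚ).obj ⊤, (gen A ℚ).γ ⊤ z = z := (gen A ℚ).identity
  rw [← this (dist _ _), ← this (dist x y)]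
  refine gen_γ_eq_of_dense fun c _ hc => ?_
  obtain ⟨d, hd, hd0, a, b, ha, hb⟩ := exists_vals x y hc
  refine ⟨d, hd, hd0, |a - b|, ?_, le_dist ha hb⟩
  simpa only [sub_zero] using
    le_dist (gen.le_map₂ (fun x y : ℚ => x - y) ha hb) (gen.le_const (0 : ℚ) d)

theorem condEquiv_iff {q p : Hom (condNat A) (gen A ℚ)} : CondEquiv q p ↔
    ∀ ε, lt (gen.const 0) ε → ∃ n₀, ∀ n, CondNat.le n₀ n →
      lt (dist (q.toFun n) (p.toFun n)) ε := by
  refine forall_congr' fun ε => forall_congr' fun _ => exists_congr fun n₀ =>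
    forall_congr' fun n => forall_congr' fun _ => ?_
  rw [← dist_sub_zero (q.toFun n) (p.toFun n)]
  rfl

theorem CondEquiv.op {f : ℚ → ℚ → ℚ} (hf : IsGoodOp f) {q p q' p' : Hom (condNat A) (gen A ℚ)}
    (hq : IsCondCauchy q) (hp' : IsCondCauchy p') (h : CondEquiv q q') (h' : CondEquiv p p') :
    CondEquiv ((seqOp (gen.map₂ A f)).toFun (q, p)) ((seqOp (gen.map₂ A f)).toFun (q', p')) := by
  rw [condEquiv_iff] at h h'
  refine condEquiv_iff.2 fun ε hε => ?_
  obtain ⟨k, hk⟩ := hq _ lt_const_one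
  obtain ⟨l, hl⟩ := hp' _ lt_const_one
  obtain ⟨δ, hδ0, hδ⟩ := exists_delta hε (q.toFun k) (p'.toFun l)
  obtain ⟨k', hk'⟩ := h δ hδ0
  obtain ⟨l', hl'⟩ := h' δ hδ0
  have hkk : CondNat.le k k := CondNat.le_iff.2 fun c hc => by
    obtain ⟨d, hd, hd0, s, hs⟩ := exists_val k.2 hc
    exact ⟨d, hd, hd0, s, s, hs, hs, le_rfl⟩
  have hll : CondNat.le l l := CondNat.le_iff.2 fun c hc => by
    obtain ⟨d, hd, hd0, s, hs⟩ := exists_val l.2 hc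
    exact ⟨d, hd, hd0, s, s, hs, hs, le_rfl⟩
  refine ⟨CondNat.max (CondNat.max k l) (CondNat.max k' l'), fun n hn => ?_⟩
  have n1 := CondNat.le_trans (CondNat.le_max_left _ _) hn
  have n2 := CondNat.le_trans (CondNat.le_max_right _ _) hn
  exact lt_of_isGoodOp hf hδ
    (hk k n hkk (CondNat.le_trans (CondNat.le_max_left _ _) n1))
    (hl l n hll (CondNat.le_trans (CondNat.le_max_right _ _) n1))
    (hk' n (CondNat.le_trans (CondNat.le_max_left _ _) n2))
    (hl' n (CondNat.le_trans (CondNat.le_max_right _ _) n2))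

theorem CondEquiv.refl (q : Hom (condNat A) (gen A ℚ)) : CondEquiv q q :=
  condEquiv_iff.2 fun ε hε => ⟨gen.const 0, fun n _ => lt_iff.2 fun c hc => by
    obtain ⟨d, hd, hd0, s, e, hs, he⟩ := exists_vals (q.toFun n) ε hc
    exact ⟨d, hd, hd0, _, e, le_dist hs hs, he,
      by simpa using lt_val hε hd0 (gen.le_const 0 d) he⟩⟩

theorem CondEquiv.symm {q p : Hom (condNat A) (gen A ℚ)} (h : CondEquiv q p) : CondEquiv p q := by
  rw [condEquiv_iff] at h ⊢
  intro ε hε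
  obtain ⟨k, hk⟩ := h ε hε
  refine ⟨k, fun n hn => lt_iff.2 fun c hc => ?_⟩
  obtain ⟨d, hd, hd0, s, t, hs, ht⟩ := exists_vals (q.toFun n) (p.toFun n) hc
  obtain ⟨d', hd', hd0', e, he⟩ := exists_val ε.2 hd0
  exact ⟨d', hd'.trans hd, hd0', _, e, le_dist (hd'.trans ht) (hd'.trans hs), he,
    by simpa only [abs_sub_comm] using dist_val (hk n hn) hd0' (hd'.trans hs) (hd'.trans ht) he⟩

theorem CondEquiv.trans {q p r : Hom (condNat A) (gen A ℚ)} (h : CondEquiv q p)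
    (h' : CondEquiv p r) : CondEquiv q r := by
  rw [condEquiv_iff] at h h' ⊢
  intro ε hε
  obtain ⟨δ, hδ0, hδ⟩ := exists_delta hε (gen.const 0) (gen.const 0)
  obtain ⟨k, hk⟩ := h δ hδ0
  obtain ⟨l, hl⟩ := h' δ hδ0
  refine ⟨CondNat.max k l, fun n hn => lt_iff.2 fun c hc => ?_⟩
  obtain ⟨d, hd, hd0, s, t, hs, ht⟩ := exists_vals (q.toFun n) (p.toFun n) hc
  obtain ⟨d', hd', hd0', v, e, hv, he⟩ := exists_vals (r.toFun n) ε hd0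
  have hδ' := hδ d' e 0 0 he (gen.le_const 0 d') (gen.le_const 0 d')
  have h1 := dist_val (hk n (CondNat.le_trans (CondNat.le_max_left _ _) hn)) hd0'
    (hd'.trans hs) (hd'.trans ht) hδ'
  have h2 := dist_val (hl n (CondNat.le_trans (CondNat.le_max_right _ _) hn)) hd0'
    (hd'.trans ht) hv hδ'
  refine ⟨d', hd'.trans hd, hd0', _, e, le_dist (hd'.trans hs) hv, he, ?_⟩
  have h3 := abs_sub_le s t v
  norm_num at h1 h2
  linarith

/-- The relation `∼` on the conditional set of conditional Cauchy sequences. -/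
noncomputable def condCauchy.rel (A : Type u) [CompleteBooleanAlgebra A] :
    Rel (condCauchy A).toCondSet (condCauchy A).toCondSet where
  primal := {x | CondEquiv x.1.1 x.2.1}
  nonempty := by
    obtain ⟨q, hq⟩ := (condCauchy A).nonempty
    have hq' := (condCauchy A).mem_at_top.2 hq
    exact ⟨(⟨q, hq'⟩, ⟨q, hq'⟩), CondEquiv.refl q⟩
  stable I a ha s hs x hx := by
    refine condEquiv_iff.2 fun ε hε => ?_
    have e1 : ∀ i, (condSeq A).γ (a i) x.1.1 = (condSeq A).γ (a i) (s i).1.1 :=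
      fun i => congrArg (fun z => z.1.1) (hx i)
    have e2 : ∀ i, (condSeq A).γ (a i) x.2.1 = (condSeq A).γ (a i) (s i).2.1 :=
      fun i => congrArg (fun z => z.2.1) (hx i)
    obtain ⟨n₀, h⟩ := glue_eventually ha (fun _ n => dist (x.1.1.toFun n) (x.2.1.toFun n))
      (fun _ _ => ε) (fun i _ n => dist ((s i).1.1.toFun n) ((s i).2.1.toFun n))
      (fun _ _ _ => ε)
      (fun i _ _ _ _ _ hn => dist_γ (condSeq_γ (e1 i) hn) (condSeq_γ (e2 i) hn))
      (fun _ _ _ _ _ _ _ => rfl)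
      (fun i => by
        obtain ⟨k, hk⟩ := condEquiv_iff.1 (hs i) ε hε
        exact ⟨k, fun _ n _ hn => hk n hn⟩)
    exact ⟨n₀, fun n hn => h n n hn hn⟩

theorem condCauchy.rel_isEquivalence : (condCauchy.rel A).IsEquivalence where
  refl _ := Rel.le_top.2 (CondEquiv.refl _)
  symm h := Rel.le_top.2 (CondEquiv.symm (Rel.le_top.1 h))
  trans h h' := Rel.le_top.2 (CondEquiv.trans (Rel.le_top.1 h) (Rel.le_top.1 h'))

theorem condCauchy.isCondCauchy (x : (condCauchy A).toCondSet.obj ⊤) : IsCondCauchy x.1 :=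
  (condCauchy A).mem_at_top.1 x.2

/-- The operation on conditional Cauchy sequences modulo `∼` given by
`[(qₙ)] * [(pₙ)] := [(qₙ * pₙ)]`. -/
noncomputable def condReal.op {f : ℚ → ℚ → ℚ} (hf : IsGoodOp f) :
    Hom (((condCauchy A).toCondSet.quotient condCauchy.rel_isEquivalence).prod
        ((condCauchy A).toCondSet.quotient condCauchy.rel_isEquivalence))
      ((condCauchy A).toCondSet.quotient condCauchy.rel_isEquivalence) :=
  quotient.map₂ condCauchy.rel_isEquivalence
    (restrictOp (condCauchy A) (seqOp (gen.map₂ A f)) fun _ hq _ hp => IsCondCauchy.op hf hq hp)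
    (fun x _ _ y' h h' => CondEquiv.op hf (condCauchy.isCondCauchy x) (condCauchy.isCondCauchy y')
      h h')

/-- For conditional sequences `(pₙ)` and `(qₙ)`: for every `ε > 0` there is `n₀` such that
`qₙ - pₙ > -ε` for all `n ≥ n₀`. -/
def EventuallyLe (p q : Hom (condNat A) (gen A ℚ)) : Prop :=
  ∀ ε, lt (gen.const 0) ε → ∃ n₀, ∀ n, CondNat.le n₀ n →
    lt ((gen.map A fun x : ℚ => -x).toFun ε)
      ((gen.map₂ A fun x y : ℚ => x - y).toFun (q.toFun n, p.toFun n))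

/-- The conditional real numbers: conditional Cauchy sequences of conditional rational numbers
modulo `∼`, with the operations and the order induced on classes. -/
noncomputable def condReal (A : Type u) [CompleteBooleanAlgebra A] : CondOrderedStr.{u, u} A where
  carrier := (condCauchy A).toCondSet.quotient condCauchy.rel_isEquivalence
  add := condReal.op isGoodOp_add
  mul := condReal.op isGoodOp_mul
  le :=
    { primal := {z | ∃ x y : (condCauchy A).toCondSet.obj ⊤,
        z.1 = quotient.mk condCauchy.rel_isEquivalence x ∧
        z.2 = quotient.mk condCauchy.rel_isEquivalence y ∧ EventuallyLe x.1 y.1}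
      nonempty := by
        obtain ⟨q, hq⟩ := (condCauchy A).nonempty
        have hq' := (condCauchy A).mem_at_top.2 hq
        refine ⟨(quotient.mk _ ⟨q, hq'⟩, quotient.mk _ ⟨q, hq'⟩),
          ⟨⟨q, hq'⟩, ⟨q, hq'⟩, rfl, rfl, fun ε hε => ⟨gen.const 0, fun n _ => lt_iff.2 fun c hc => ?_⟩⟩⟩
        obtain ⟨d, hd, hd0, s, e, hs, he⟩ := exists_vals (Fun.toFun q n) ε hc
        have := lt_val hε hd0 (gen.le_const 0 d) he
        exact ⟨d, hd, hd0, _, _, gen.le_map _ he, gen.le_map₂ _ hs hs, by simpa using this⟩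
      stable := fun I a ha z hz w hw => by
        choose x y hx hy hxy using hz
        obtain ⟨p, hp, -⟩ := (condCauchy A).toCondSet.stability I a ha
          (fun i => (condCauchy A).toCondSet.γ (a i) (x i))
        obtain ⟨q, hq, -⟩ := (condCauchy A).toCondSet.stability I a ha
          (fun i => (condCauchy A).toCondSet.γ (a i) (y i))
        have hmk : ∀ b u v, (condCauchy A).toCondSet.γ b u = (condCauchy A).toCondSet.γ b v →
            ((condCauchy A).toCondSet.quotient condCauchy.rel_isEquivalence).γ b
              (quotient.mk _ u) =
            ((condCauchy A).toCondSet.quotient condCauchy.rel_isEquivalence).γ b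
              (quotient.mk _ v) := fun b u v h => congrArg Quotient.mk'' h
        refine ⟨p, q, ?_, ?_, fun ε hε => ?_⟩
        · refine CondSet.eq_of_partition _ ha fun i => ?_
          exact (congrArg Prod.fst (hw i)).trans
            ((congrArg _ (hx i)).trans (hmk _ _ _ (hp i).symm))
        · refine CondSet.eq_of_partition _ ha fun i => ?_
          exact (congrArg Prod.snd (hw i)).trans
            ((congrArg _ (hy i)).trans (hmk _ _ _ (hq i).symm))
        · have e1 : ∀ i, (condSeq A).γ (a i) p.1 = (condSeq A).γ (a i) (x i).1 :=
            fun i => congrArg Subtype.val (hp i)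
          have e2 : ∀ i, (condSeq A).γ (a i) q.1 = (condSeq A).γ (a i) (y i).1 :=
            fun i => congrArg Subtype.val (hq i)
          obtain ⟨n₀, h⟩ := glue_eventually ha (fun _ _ => (gen.map A fun x : ℚ => -x).toFun ε)
            (fun _ n => (gen.map₂ A fun x y : ℚ => x - y).toFun (q.1.toFun n, p.1.toFun n))
            (fun _ _ _ => (gen.map A fun x : ℚ => -x).toFun ε)
            (fun i _ n =>
              (gen.map₂ A fun x y : ℚ => x - y).toFun ((y i).1.toFun n, (x i).1.toFun n))
            (fun _ _ _ _ _ _ _ => rfl)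
            (fun i _ _ _ _ _ hn => Fun.γ_eq _
              (Prod.ext (condSeq_γ (e2 i) hn) (condSeq_γ (e1 i) hn)))
            (fun i => by
              obtain ⟨k, hk⟩ := hxy i ε hε
              exact ⟨k, fun _ n _ hn => hk n hn⟩)
          exact ⟨n₀, fun n hn => h n n hn hn⟩ }

end Real

/-! The proof treats the nonzero elements of the Boolean algebra as conditions, in the manner of
forcing. An element `x` of a generated conditional set has the value `z` below a condition `c` when
`c ≤ x.1 z`. Below every condition there is a smaller one where `x` has a value, and this value is
unique. Hence identities and inequalities in 𝐐 may be checked on rational values, below densely many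
conditions.

The same works for quantifiers over ε and indices. Locally, a conditional n₀ is a standard number;
conversely, standard numbers chosen densely can be glued into one conditional number
(`exists_condNat`). So `eventually_iff_local` reduces the Cauchy property, `∼` and `≤` to statements
about standard ε, standard indices and rational values below small conditions. Equality, `≤` and `<`
of classes on a condition `b` become `LocEq b`, `LocLe b` and `LocLt b` (`γ_mk`, `le_γ_mk`,
`lt_γ_mk`).

The analytic core is `IsCondCauchy.trichotomy`: below any condition, for given `e`, some smaller
condition decides whether two Cauchy sequences are eventually `e`-close or eventually separated by
`e / 2` in a definite direction. It makes strict inequality the same as a locally uniform gap, it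
yields the partition required by totality, and it bounds an element apart from 0 locally away from
0, so that the termwise inverse is Cauchy.

The ring axioms already hold termwise for sequences, since they hold for rational values. Finally, 𝐐
embeds by constant sequences. The embedding is local (`γ_ofRat`), so its image is stable, and
inverses computed in 𝐐 remain in the image. -/

open CondRat CondOrderedStr

/-! ### Values of elements of generated conditional sets, and gluing of standard numbers -/

namespace CondSet

variable {A : Type u} [CompleteBooleanAlgebra A] {E F G : Type w} [Nonempty E] [Nonempty F]
  [Nonempty G]

/-- Converse of `gen.le_map₂`. The arguments need not have values below `c` itself, so the condition
has to shrink; uniqueness of values then identifies `z`. -/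
theorem gen.map₂_val (f : E → F → G) {x : (gen A E).obj ⊤} {y : (gen A F).obj ⊤} {c : A}
    (hc : c ≠ ⊥) {z : G} (hz : c ≤ ((gen.map₂ A f).toFun (x, y)).1 z) :
    ∃ d ≤ c, d ≠ ⊥ ∧ ∃ s t, d ≤ x.1 s ∧ d ≤ y.1 t ∧ z = f s t := by
  obtain ⟨d, hd, hd0, s, hs⟩ := exists_val x.2 hc
  obtain ⟨d', hd', hd0', t, ht⟩ := exists_val y.2 hd0
  exact ⟨d', hd'.trans hd, hd0', s, t, hd'.trans hs, ht,
    val_unique ((gen.map₂ A f).toFun (x, y)).2 hd0' ((hd'.trans hd).trans hz)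
      (gen.le_map₂ f (hd'.trans hs) ht)⟩

theorem gen.map_val (f : E → F) {x : (gen A E).obj ⊤} {c : A}
    (hc : c ≠ ⊥) {z : F} (hz : c ≤ ((gen.map A f).toFun x).1 z) :
    ∃ d ≤ c, d ≠ ⊥ ∧ ∃ s, d ≤ x.1 s ∧ z = f s := by
  obtain ⟨d, hd, hd0, s, hs⟩ := exists_val x.2 hc
  exact ⟨d, hd, hd0, s, hs, val_unique ((gen.map A f).toFun x).2 hd0 (hd.trans hz)
      (gen.le_map f hs)⟩

theorem gen.const_val {e z : E} {c : A} (hc : c ≠ ⊥) (hz : c ≤ (gen.const (A := A) e).1 z) :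
    z = e :=
  val_unique (gen.const (A := A) e).2 hc hz (gen.le_const e c)

/-- This is what reduces identities between conditional rationals to identities in ℚ. -/
theorem gen.eq_of_dense {x y : (gen A E).obj ⊤}
    (h : ∀ c : A, c ≠ ⊥ → ∃ d ≤ c, d ≠ ⊥ ∧ ∃ z, d ≤ x.1 z ∧ d ≤ y.1 z) : x = y := by
  rw [← (gen A E).identity x, ← (gen A E).identity y]
  exact gen_γ_eq_of_dense fun c _ hc => h c hc

/-- Allows a conditional index to be replaced by a standard one below a small condition. -/
theorem gen.γ_const {x : (gen A E).obj ⊤} {e : E} {c : A} (h : c ≤ x.1 e) :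
    (gen A E).γ c x = (gen A E).γ c (gen.const e) :=
  gen_γ_eq_of_dense fun d hd hd0 => ⟨d, le_rfl, hd0, e, hd.trans h, gen.le_const e d⟩

theorem gen.le_of_γ {x y : (gen A E).obj ⊤} {a c : A} (h : (gen A E).γ a x = (gen A E).γ a y)
    (hc : c ≤ a) {z : E} (hz : c ≤ x.1 z) : c ≤ y.1 z := gen_γ_eq.1 h c hc z hz

/-- A property of natural numbers which holds densely for some natural number holds, densely, for
the values of a single conditional natural number. -/
theorem exists_condNat {P : A → ℕ → Prop}
    (h : ∀ c : A, c ≠ ⊥ → ∃ d ≤ c, d ≠ ⊥ ∧ ∃ N, P d N) (hP : ∀ d d' N, d' ≤ d → P d N → P d' N) :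
    ∃ n : (condNat A).obj ⊤, ∀ (c : A) N, c ≠ ⊥ → c ≤ n.1 N → ∃ d ≤ c, d ≠ ⊥ ∧ P d N := by
  -- The suprema `g N` cover ⊤ by density but may overlap; `disjointed` assigns each piece to the
  -- first `N` covering it, which gives a partition indexed by ℕ.
  let g : ℕ → A := fun N => ⨆ d : {d : A // P d N}, d.1
  have hdis : ∀ i j, i ≠ j → disjointed g i ⊓ disjointed g j = ⊥ := fun i j hij =>
    disjoint_iff.1 (disjoint_disjointed g hij)
  refine ⟨⟨disjointed g, hdis, ?_⟩, fun c N hc hN => ?_⟩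
  · rw [iSup_disjointed, ← compl_eq_bot]
    by_contra hc
    obtain ⟨d, hd, hd0, N, hN⟩ := h _ hc
    have : d ≤ ⨆ N, g N := le_iSup_of_le N (le_iSup_of_le ⟨d, hN⟩ le_rfl)
    exact hd0 (disjoint_self.1 (Disjoint.mono this hd disjoint_compl_right))
  -- `P` need not hold on the supremum `g N`. But `c` meets some `d` with `P d N`, and `P` passes
  -- down to the meet.
  · have h1 : c ≤ g N := hN.trans (disjointed_le g N)
    have h2 : c ⊓ g N ≠ ⊥ := by rwa [inf_eq_left.2 h1]
    rw [inf_iSup_eq] at h2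
    by_contra hn
    refine h2 (iSup_eq_bot.2 fun d => ?_)
    by_contra h3
    exact hn ⟨_, inf_le_left, h3, hP d.1 _ N inf_le_right d.2⟩

end CondSet

/-! ### Reduction of conditional quantifiers to standard ε and standard indices -/

section LocalCharacterisations

variable {A : Type u} [CompleteBooleanAlgebra A]

theorem CondRat.lt_iff_val {x y : (gen A ℚ).obj ⊤} : lt x y ↔
    ∀ c : A, c ≠ ⊥ → ∀ s t : ℚ, c ≤ x.1 s → c ≤ y.1 t → s < t :=
  ⟨fun h _ hc _ _ hs ht => lt_val h hc hs ht, fun h => lt_iff.2 fun c hc => by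
    obtain ⟨d, hd, hd0, s, t, hs, ht⟩ := exists_vals x y hc
    exact ⟨d, hd, hd0, s, t, hs, ht, h d hd0 s t hs ht⟩⟩

theorem CondRat.lt_const {s t : ℚ} (h : s < t) : lt (gen.const (A := A) s) (gen.const t) :=
  lt_iff.2 fun c hc => ⟨c, le_rfl, hc, s, t, gen.le_const s c, gen.le_const t c, h⟩

/-- Conditional statements of the form `∀ ε > 0, ∃ n₀, ∀ m n ≥ n₀` hold if and only if they hold
densely for standard numbers. -/
theorem eventually_iff_local (G H : (condNat A).obj ⊤ → (condNat A).obj ⊤ → (gen A ℚ).obj ⊤)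
    (hG : ∀ a m n m' n', (condNat A).γ a m = (condNat A).γ a m' →
      (condNat A).γ a n = (condNat A).γ a n' → (gen A ℚ).γ a (G m n) = (gen A ℚ).γ a (G m' n'))
    (hH : ∀ a m n m' n', (condNat A).γ a m = (condNat A).γ a m' →
      (condNat A).γ a n = (condNat A).γ a n' → (gen A ℚ).γ a (H m n) = (gen A ℚ).γ a (H m' n'))
    (P : ℚ → ℚ → ℚ → Prop) :
    (∀ ε : (gen A ℚ).obj ⊤, lt (gen.const 0) ε → ∃ n₀, ∀ m n, CondNat.le n₀ m → CondNat.le n₀ n →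
      ∀ c : A, c ≠ ⊥ → ∀ s t e, c ≤ (G m n).1 s → c ≤ (H m n).1 t → c ≤ ε.1 e → P e s t) ↔
    ∀ e : ℚ, 0 < e → ∀ c : A, c ≠ ⊥ → ∃ d ≤ c, d ≠ ⊥ ∧ ∃ N : ℕ, ∀ m ≥ N, ∀ n ≥ N, ∀ d' ≤ d,
      d' ≠ ⊥ → ∀ s t, d' ≤ (G (gen.const m) (gen.const n)).1 s →
        d' ≤ (H (gen.const m) (gen.const n)).1 t → P e s t := by
  constructor
  · intro h e he c hc
    obtain ⟨n₀, h⟩ := h _ (lt_const he)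
    obtain ⟨d, hd, hd0, N, hN⟩ := exists_val n₀.2 hc
    -- A standard `m ≥ N` need not dominate `n₀` away from `d`. Its maximum with `n₀` does, and
    -- agrees with `m` on `d`, where `n₀` has the value `N`.
    have key : ∀ m ≥ N, (condNat A).γ d (gen.const m) =
        (condNat A).γ d (CondNat.max (gen.const m) n₀) := fun m hm =>
      gen_γ_eq_of_dense fun c hc hc0 => ⟨c, le_rfl, hc0, m, gen.le_const m c, by
        have := gen.le_map₂ Max.max (gen.le_const m c) (hc.trans hN)
        rwa [max_eq_left hm] at this⟩
    refine ⟨d, hd, hd0, N, fun m hm n hn d' hd' hd0' s t hs ht => ?_⟩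
    exact h _ _ (CondNat.le_max_right (gen.const m) n₀) (CondNat.le_max_right (gen.const n) n₀)
      d' hd0' s t e (gen.le_of_γ (hG d _ _ _ _ (key m hm) (key n hn)) hd' hs)
      (gen.le_of_γ (hH d _ _ _ _ (key m hm) (key n hn)) hd' ht) (gen.le_const e d')
  · intro h ε hε
    -- The predicate includes the local value of `ε`, so one glued `n₀` serves all the values that
    -- `ε` takes on different conditions.
    obtain ⟨n₀, hn₀⟩ := exists_condNat (A := A) (P := fun d N => ∃ e, d ≤ ε.1 e ∧
      ∀ m ≥ N, ∀ n ≥ N, ∀ d' ≤ d,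
      d' ≠ ⊥ → ∀ s t, d' ≤ (G (gen.const m) (gen.const n)).1 s →
        d' ≤ (H (gen.const m) (gen.const n)).1 t → P e s t) (by
        intro c hc
        obtain ⟨d, hd, hd0, e, he⟩ := exists_val ε.2 hc
        obtain ⟨d', hd', hd0', N, hN⟩ := h e (lt_val hε hd0 (gen.le_const 0 d) he) d hd0
        exact ⟨d', hd'.trans hd, hd0', N, e, hd'.trans he, hN⟩) (by
        rintro d d' N hd ⟨e, he, H⟩
        exact ⟨e, hd.trans he, fun m hm n hn d'' hd'' => H m hm n hn d'' (hd''.trans hd)⟩)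
    refine ⟨n₀, fun m n hm hn c hc s t e hs ht he => ?_⟩
    -- Shrink until `n₀`, `m` and `n` all have values; `m` and `n` may then be replaced by constants
    -- `k, l ≥ N`.
    obtain ⟨c₁, hc₁, hc₁0, N, hN⟩ := exists_val n₀.2 hc
    obtain ⟨c₂, hc₂, hc₂0, e', he', H⟩ := hn₀ c₁ N hc₁0 hN
    obtain ⟨c₃, hc₃, hc₃0, k, hk⟩ := exists_val m.2 hc₂0
    obtain ⟨c₄, hc₄, hc₄0, l, hl⟩ := exists_val n.2 hc₃0
    have h2 : c₄ ≤ c₂ := hc₄.trans hc₃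
    have h1 : c₄ ≤ c₁ := h2.trans hc₂
    have h0 : c₄ ≤ c := h1.trans hc₁
    obtain rfl := val_unique ε.2 hc₄0 (h0.trans he) (h2.trans he')
    have em := gen.γ_const (hc₄.trans hk)
    have en := gen.γ_const hl
    exact H k (CondNat.le_val hm hc₄0 (h1.trans hN) (hc₄.trans hk)) l
      (CondNat.le_val hn hc₄0 (h1.trans hN) hl) c₄ h2 hc₄0 s t
      (gen.le_of_γ (hG _ _ _ _ _ em en) le_rfl (h0.trans hs))
      (gen.le_of_γ (hH _ _ _ _ _ em en) le_rfl (h0.trans ht))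

/-! ### Calculus of the local relations between sequences -/

/-- Below `d`, the values of the sequences `p` and `q` at all standard `n ≥ N` are related
by `P`. -/
def EvOn (d : A) (N : ℕ) (P : ℚ → ℚ → Prop) (p q : Hom (condNat A) (gen A ℚ)) : Prop :=
  ∀ n ≥ N, ∀ c ≤ d, c ≠ ⊥ → ∀ s t, c ≤ (p.toFun (gen.const n)).1 s →
    c ≤ (q.toFun (gen.const n)).1 t → P s t

/-- The values of `p` and `q` are eventually related by `P`, densely below `b`. -/
def LocEv (b : A) (P : ℚ → ℚ → Prop) (p q : Hom (condNat A) (gen A ℚ)) : Prop :=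
  ∀ c ≤ b, c ≠ ⊥ → ∃ d ≤ c, d ≠ ⊥ ∧ ∃ N, EvOn d N P p q

/-- The difference of `p` and `q` tends to `0` on `b`. -/
def LocEq (b : A) (p q : Hom (condNat A) (gen A ℚ)) : Prop :=
  ∀ e : ℚ, 0 < e → LocEv b (fun s t => |s - t| < e) p q

/-- The sequence `p` is eventually at most `q` on `b`, up to arbitrarily small errors. -/
def LocLe (b : A) (p q : Hom (condNat A) (gen A ℚ)) : Prop :=
  ∀ e : ℚ, 0 < e → LocEv b (fun s t => s < t + e) p q

/-- Densely below `b`, the sequence `q` eventually exceeds `p` by a positive constant. -/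
def LocLt (b : A) (p q : Hom (condNat A) (gen A ℚ)) : Prop :=
  ∀ c ≤ b, c ≠ ⊥ → ∃ d ≤ c, d ≠ ⊥ ∧ ∃ e : ℚ, 0 < e ∧ ∃ N, EvOn d N (fun s t => s + e < t) p q

variable {p q r : Hom (condNat A) (gen A ℚ)} {a b c d : A} {P Q R : ℚ → ℚ → Prop}

theorem EvOn.mono {N M : ℕ} (h : EvOn d N P p q) (hc : c ≤ d) (hN : N ≤ M)
    (hP : ∀ s t, P s t → Q s t) : EvOn c M Q p q :=
  fun n hn c' hc' h0 s t hs ht => hP s t (h n (hN.trans hn) c' (hc'.trans hc) h0 s t hs ht)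

theorem EvOn.comp {N : ℕ} (h : EvOn d N P p q) (h' : EvOn d N Q q r)
    (hR : ∀ s t u, P s t → Q t u → R s u) : EvOn d N R p r := by
  intro n hn c hc h0 s u hs hu
  -- The middle sequence may have no value below `c`; shrinking supplies one, and `R s u` does not
  -- depend on the condition.
  obtain ⟨c', hc', h0', t, ht⟩ := exists_val (q.toFun (gen.const n)).2 h0
  exact hR s t u (h n hn c' (hc'.trans hc) h0' s t (hc'.trans hs) ht)
    (h' n hn c' (hc'.trans hc) h0' t u ht (hc'.trans hu))

/-- `EvOn` is universal over values, so refuting incompatible bounds requires that values exist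
below some nonzero condition. -/
theorem EvOn.exists {N : ℕ} (h : EvOn d N P p q) (hd : d ≠ ⊥) : ∃ s t, P s t := by
  obtain ⟨c, hc, h0, s, t, hs, ht⟩ :=
    exists_vals (p.toFun (gen.const N)) (q.toFun (gen.const N)) hd
  exact ⟨s, t, h N le_rfl c hc h0 s t hs ht⟩

theorem EvOn.swap {N : ℕ} (h : EvOn d N P p q) : EvOn d N (fun s t => P t s) q p :=
  fun n hn c hc h0 s t hs ht => h n hn c hc h0 t s ht hs

theorem EvOn.and {N : ℕ} (h : EvOn d N P p q) (h' : EvOn d N Q p q) :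
    EvOn d N (fun s t => P s t ∧ Q s t) p q :=
  fun n hn c hc h0 s t hs ht => ⟨h n hn c hc h0 s t hs ht, h' n hn c hc h0 s t hs ht⟩

theorem LocEv.mono (h : LocEv b P p q) (hb : a ≤ b) (hP : ∀ s t, P s t → Q s t) :
    LocEv a Q p q := by
  intro c hc h0
  obtain ⟨d, hd, hd0, N, H⟩ := h c (hc.trans hb) h0
  exact ⟨d, hd, hd0, N, H.mono le_rfl le_rfl hP⟩

theorem LocEv.comp (h : LocEv b P p q) (h' : LocEv b Q q r)
    (hR : ∀ s t u, P s t → Q t u → R s u) : LocEv b R p r := by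
  intro c hc h0
  obtain ⟨d, hd, hd0, N, H⟩ := h c hc h0
  obtain ⟨d', hd', hd0', N', H'⟩ := h' d (hd.trans hc) hd0
  exact ⟨d', hd'.trans hd, hd0', max N N', (H.mono hd' (le_max_left _ _) fun _ _ h => h).comp
    (H'.mono le_rfl (le_max_right _ _) fun _ _ h => h) hR⟩

theorem LocEv.and (h : LocEv b P p q) (h' : LocEv b Q p q) :
    LocEv b (fun s t => P s t ∧ Q s t) p q := by
  intro c hc h0
  obtain ⟨d, hd, hd0, N, H⟩ := h c hc h0
  obtain ⟨d', hd', hd0', N', H'⟩ := h' d (hd.trans hc) hd0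
  exact ⟨d', hd'.trans hd, hd0', max N N', (H.mono hd' (le_max_left _ _) fun _ _ h => h).and
    (H'.mono le_rfl (le_max_right _ _) fun _ _ h => h)⟩

theorem LocEv.swap (h : LocEv b P p q) : LocEv b (fun s t => P t s) q p := by
  intro c hc h0
  obtain ⟨d, hd, hd0, N, H⟩ := h c hc h0
  exact ⟨d, hd, hd0, N, H.swap⟩

theorem LocEv.of_forall (h : ∀ n : ℕ, ∀ c ≤ b, c ≠ ⊥ → ∀ s t, c ≤ (p.toFun (gen.const n)).1 s →
    c ≤ (q.toFun (gen.const n)).1 t → P s t) : LocEv b P p q :=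
  fun c hc h0 => ⟨c, le_rfl, h0, 0, fun n _ c' hc' => h n c' (hc'.trans hc)⟩

theorem LocEq.of_γ (h : (condSeq A).γ b p = (condSeq A).γ b q) : LocEq b p q := by
  intro e he
  refine LocEv.of_forall fun n c hc h0 s t hs ht => ?_
  obtain rfl := val_unique (q.toFun (gen.const n)).2 h0
    (gen.le_of_γ (Hom.restrict_eq_iff.1 h (gen.const n)) hc hs) ht
  simpa using he

theorem LocEq.mono (h : LocEq b p q) (hb : a ≤ b) : LocEq a p q :=
  fun e he => (h e he).mono hb fun _ _ h => h

theorem LocEq.symm (h : LocEq b p q) : LocEq b q p :=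
  fun e he => (h e he).swap.mono le_rfl fun _ _ h => by rwa [abs_sub_comm]

theorem LocEq.trans (h : LocEq b p q) (h' : LocEq b q r) : LocEq b p r := fun e he =>
  (h _ (half_pos he)).comp (h' _ (half_pos he)) fun s t u h1 h2 => by
    have := abs_sub_le s t u
    linarith

theorem LocEq.le (h : LocEq b p q) : LocLe b p q :=
  fun e he => (h e he).mono le_rfl fun s t h => by
    have := (abs_lt.1 h).2
    linarith

theorem LocLe.trans (h : LocLe b p q) (h' : LocLe b q r) : LocLe b p r := fun e he =>
  (h _ (half_pos he)).comp (h' _ (half_pos he)) fun s t u h1 h2 => by linarith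

theorem LocLe.antisymm (h : LocLe b p q) (h' : LocLe b q p) : LocEq b p q := fun e he =>
  ((h e he).and (h' e he).swap).mono le_rfl fun s t h => by
    rw [abs_lt]
    constructor <;> linarith [h.1, h.2]

/-- Local statements hold as soon as they hold on `b` and on the complement of `b`. -/
theorem LocEv.of_compl (h : LocEv b P p q) (h' : LocEv bᶜ P p q) : LocEv ⊤ P p q := by
  intro c _ h0
  by_cases hb : c ⊓ b = ⊥
  · exact h' c (le_compl_iff_disjoint_right.2 (disjoint_iff.2 hb)) h0
  · obtain ⟨d, hd, hd0, H⟩ := h _ inf_le_right hb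
    exact ⟨d, hd.trans inf_le_left, hd0, H⟩

theorem LocLt.le (h : LocLt b p q) : LocLe b p q := by
  intro e he c hc h0
  obtain ⟨d, hd, hd0, e', he', N, H⟩ := h c hc h0
  exact ⟨d, hd, hd0, N, H.mono le_rfl le_rfl fun s t h => by linarith⟩

/-- Using the gap `e` of the strict inequality as tolerance in the reverse one gives `s + e < t < s
+ e` at a common index. -/
theorem LocLt.eq_bot (h : LocLt b p q) (hab : a ≤ b) (h' : LocLe a q p) : a = ⊥ := by
  by_contra h0
  obtain ⟨d, hd, hd0, e, he, N, H⟩ := h a hab h0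
  obtain ⟨d', hd', hd0', N', H'⟩ := h' e he d hd hd0
  obtain ⟨s, t, h1, h2⟩ := ((H.mono hd' (le_max_left N N') fun _ _ h => h).and
    (H'.swap.mono le_rfl (le_max_right N N') fun _ _ h => h)).exists hd0'
  linarith

theorem isCondCauchy_iff : IsCondCauchy q ↔ ∀ e : ℚ, 0 < e → ∀ c : A, c ≠ ⊥ → ∃ d ≤ c, d ≠ ⊥ ∧
    ∃ N : ℕ, ∀ m ≥ N, ∀ n ≥ N, ∀ d' ≤ d, d' ≠ ⊥ → ∀ s t, d' ≤ (q.toFun (gen.const m)).1 s →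
      d' ≤ (q.toFun (gen.const n)).1 t → |t - s| < e := by
  rw [← eventually_iff_local (fun m _ => q.toFun m) (fun _ n => q.toFun n)
    (fun _ _ _ _ _ h _ => q.γ_eq h) (fun _ _ _ _ _ _ h => q.γ_eq h) (fun e s t => |t - s| < e)]
  refine forall_congr' fun ε => forall_congr' fun _ => exists_congr fun n₀ =>
    forall_congr' fun m => forall_congr' fun n => forall_congr' fun _ => forall_congr' fun _ => ?_
  refine ⟨fun h c hc s t e hs ht he => dist_val h hc ht hs he, fun h => lt_iff_val.2 ?_⟩
  intro c hc s t hs ht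
  obtain ⟨d, hd, hd0, x, y, hx, hy⟩ := exists_vals (q.toFun m) (q.toFun n) hc
  obtain rfl := val_unique (CondRat.dist _ _).2 hd0 (le_dist hy hx) (hd.trans hs)
  -- The distance may have a value below `c` where the two terms have none. Below `d` they do, and
  -- uniqueness identifies the distance with the absolute difference.
  exact h d hd0 x y t hx hy (hd.trans ht)

theorem condEquiv_iff_locEq : CondEquiv p q ↔ LocEq ⊤ p q := by
  rw [condEquiv_iff]
  -- Only one index matters here; the first is a dummy.
  have := eventually_iff_local (fun _ n => p.toFun n) (fun _ n => q.toFun n)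
    (fun _ _ _ _ _ _ h => p.γ_eq h) (fun _ _ _ _ _ _ h => q.γ_eq h) (fun e s t => |s - t| < e)
  refine Iff.trans ?_ (this.trans ?_)
  · refine forall_congr' fun ε => forall_congr' fun _ => exists_congr fun n₀ => ?_
    refine ⟨fun h m n _ hn c hc s t e hs ht he => dist_val (h n hn) hc hs ht he,
      fun h n hn => lt_iff_val.2 ?_⟩
    intro c hc s t hs ht
    obtain ⟨d, hd, hd0, x, y, hx, hy⟩ := exists_vals (p.toFun n) (q.toFun n) hc
    obtain rfl := val_unique (CondRat.dist _ _).2 hd0 (le_dist hx hy) (hd.trans hs)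
    exact h n n hn hn d hd0 x y t hx hy (hd.trans ht)
  · refine forall_congr' fun e => forall_congr' fun _ => ?_
    refine ⟨fun h c _ hc => ?_, fun h c hc => ?_⟩
    · obtain ⟨d, hd, hd0, N, H⟩ := h c hc
      exact ⟨d, hd, hd0, N, fun n hn => H n hn n hn⟩
    · obtain ⟨d, hd, hd0, N, H⟩ := h c le_top hc
      exact ⟨d, hd, hd0, N, fun _ _ n hn => H n hn⟩

theorem eventuallyLe_iff_locLe : EventuallyLe p q ↔ LocLe ⊤ p q := by
  have := eventually_iff_local (fun _ n => p.toFun n) (fun _ n => q.toFun n)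
    (fun _ _ _ _ _ _ h => p.γ_eq h) (fun _ _ _ _ _ _ h => q.γ_eq h) (fun e s t => s < t + e)
  refine Iff.trans ?_ (this.trans ?_)
  · refine forall_congr' fun ε => forall_congr' fun _ => exists_congr fun n₀ => ?_
    refine ⟨fun h m n _ hn c hc s t e hs ht he => ?_, fun h n hn => lt_iff_val.2 ?_⟩
    · have := lt_val (h n hn) hc (gen.le_map _ he) (gen.le_map₂ _ ht hs)
      linarith
    · intro c hc s t hs ht
      obtain ⟨d, hd, hd0, e, he, rfl⟩ := gen.map_val _ hc hs
      obtain ⟨d', hd', hd0', x, y, hx, hy, rfl⟩ := gen.map₂_val _ hd0 (hd.trans ht)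
      have := h n n hn hn d' hd0' y x e hy hx (hd'.trans he)
      linarith
  · refine forall_congr' fun e => forall_congr' fun _ => ?_
    refine ⟨fun h c _ hc => ?_, fun h c hc => ?_⟩
    · obtain ⟨d, hd, hd0, N, H⟩ := h c hc
      exact ⟨d, hd, hd0, N, fun n hn => H n hn n hn⟩
    · obtain ⟨d, hd, hd0, N, H⟩ := h c le_top hc
      exact ⟨d, hd, hd0, N, fun _ _ n hn => H n hn⟩

/-! ### Local comparison of Cauchy sequences -/

/-- Locally, two Cauchy sequences are eventually close to each other or eventually strictly
ordered. -/
theorem IsCondCauchy.trichotomy (hp : IsCondCauchy p) (hq : IsCondCauchy q) {e : ℚ} (he : 0 < e)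
    (hc : c ≠ ⊥) : ∃ d ≤ c, d ≠ ⊥ ∧ ∃ N, EvOn d N (fun s t => |s - t| < e) p q ∨
      EvOn d N (fun s t => s + e / 2 < t) p q ∨ EvOn d N (fun s t => s + e / 2 < t) q p := by
  -- With both oscillations below `e / 8`, the difference of the terms moves by less than `e / 4`.
  -- Testing one index against `3 / 4 * e` therefore gives either a distance below `e` or a gap
  -- above `e / 2` throughout the tail.
  obtain ⟨d, hd, hd0, N, H⟩ := isCondCauchy_iff.1 hp (e / 8) (by positivity) c hc
  obtain ⟨d', hd', hd0', M, H'⟩ := isCondCauchy_iff.1 hq (e / 8) (by positivity) d hd0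
  obtain ⟨d₂, hd₂, hd₂0, s₀, t₀, hs₀, ht₀⟩ := exists_vals (p.toFun (gen.const (max N M)))
    (q.toFun (gen.const (max N M))) hd0'
  have key : EvOn d₂ (max N M) (fun s t => |s - s₀| < e / 8 ∧ |t - t₀| < e / 8) p q :=
    fun n hn c hc h0 s t hs ht =>
      ⟨H _ (le_max_left N M) n ((le_max_left N M).trans hn) c ((hc.trans hd₂).trans hd') h0
        s₀ s (hc.trans hs₀) hs,
       H' _ (le_max_right N M) n ((le_max_right N M).trans hn) c (hc.trans hd₂) h0
        t₀ t (hc.trans ht₀) ht⟩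
  refine ⟨d₂, (hd₂.trans hd').trans hd, hd₂0, max N M, ?_⟩
  rcases lt_or_ge |s₀ - t₀| (3 / 4 * e) with h | h
  · refine Or.inl (key.mono le_rfl le_rfl fun s t h' => ?_)
    rw [abs_lt] at h ⊢
    have h1 := abs_lt.1 h'.1
    have h2 := abs_lt.1 h'.2
    constructor <;> linarith [h1.1, h1.2, h2.1, h2.2, h.1, h.2]
  · rcases le_abs.1 h with h | h
    · refine Or.inr (Or.inr (key.swap.mono le_rfl le_rfl fun s t h' => ?_))
      have h1 := abs_lt.1 h'.1
      have h2 := abs_lt.1 h'.2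
      linarith [h1.1, h1.2, h2.1, h2.2]
    · refine Or.inr (Or.inl (key.mono le_rfl le_rfl fun s t h' => ?_))
      have h1 := abs_lt.1 h'.1
      have h2 := abs_lt.1 h'.2
      linarith [h1.1, h1.2, h2.1, h2.2]

/-- A sequence which is nowhere equivalent to `q` and not larger than `q` is smaller by a locally
constant positive gap. -/
theorem locLt_of_locLe (hp : IsCondCauchy p) (hq : IsCondCauchy q) (h : LocLe b p q)
    (h' : ∀ c ≤ b, LocEq c p q → c = ⊥) : LocLt b p q := by
  intro c hc h0
  -- If no nonzero condition below `c` carried a gap, trichotomy would leave only closeness for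
  -- every `e`, making the sequences equivalent on `c`.
  by_contra hn
  refine h0 (h' c hc fun e he c' hc' h0' => ?_)
  obtain ⟨d, hd, hd0, N, H | H | H⟩ := hp.trichotomy hq he h0'
  · exact ⟨d, hd, hd0, N, H⟩
  · exact absurd ⟨d, hd.trans hc', hd0, _, half_pos he, N, H⟩ hn
  -- A gap `e / 2` in the wrong direction contradicts `h` with tolerance `e / 2`.
  · obtain ⟨d', hd', hd0', N', H'⟩ := h _ (half_pos he) d ((hd.trans hc').trans hc) hd0
    obtain ⟨s, t, h1, h2⟩ := ((H.mono hd' (le_max_left N N') fun _ _ h => h).and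
      (H'.swap.mono le_rfl (le_max_right N N') fun _ _ h => h)).exists hd0'
    linarith

/-- Any two Cauchy sequences are compared by a partition of three conditions. -/
theorem exists_partition (hp : IsCondCauchy p) (hq : IsCondCauchy q) :
    ∃ a b c : A, IsPartition ⊤ ![a, b, c] ∧ LocLt a p q ∧ LocLt b q p ∧ LocEq c p q := by
  -- Conditions that carry a single gap and a single starting index. Their supremum need not carry
  -- either uniformly, but `LocLt` only asks for them densely.
  let S : Hom (condNat A) (gen A ℚ) → Hom (condNat A) (gen A ℚ) → Set A := fun p q =>
    {d | ∃ e : ℚ, 0 < e ∧ ∃ N, EvOn d N (fun s t => s + e < t) p q}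
  have hS : ∀ p q, LocLt (sSup (S p q)) p q := by
    intro p q c hc h0
    rw [← inf_eq_left.2 hc, inf_sSup_eq] at h0
    by_contra hn
    refine h0 (iSup₂_eq_bot.2 fun d hd => ?_)
    by_contra h1
    obtain ⟨e, he, N, H⟩ := hd
    exact hn ⟨_, inf_le_left, h1, e, he, N, H.mono inf_le_right le_rfl fun _ _ h => h⟩
  have hab : sSup (S p q) ⊓ sSup (S q p) = ⊥ :=
    (hS p q).eq_bot inf_le_left fun e he => ((hS q p).le e he).mono inf_le_right fun _ _ h => h
  refine ⟨sSup (S p q), sSup (S q p), (sSup (S p q) ⊔ sSup (S q p))ᶜ, ⟨?_, ?_⟩, hS p q, hS q p, ?_⟩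
  · have h1 : sSup (S p q) ⊓ (sSup (S p q) ⊔ sSup (S q p))ᶜ = ⊥ :=
      (disjoint_compl_right.mono_left le_sup_left).eq_bot
    have h2 : sSup (S q p) ⊓ (sSup (S p q) ⊔ sSup (S q p))ᶜ = ⊥ :=
      (disjoint_compl_right.mono_left le_sup_right).eq_bot
    have hba := (inf_comm _ _).trans hab
    have h1' := (inf_comm _ _).trans h1
    have h2' := (inf_comm _ _).trans h2
    intro i j hij
    fin_cases i <;> fin_cases j <;> first | exact absurd rfl hij | assumption
  · apply le_antisymm le_top
    rw [← sup_compl_eq_top (x := sSup (S p q) ⊔ sSup (S q p))]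
    exact sup_le (sup_le (le_iSup ![_, _, _] 0) (le_iSup ![_, _, _] 1)) (le_iSup ![_, _, _] 2)
  -- Outside both suprema a gap is impossible, since its condition would belong to `S`; trichotomy
  -- leaves closeness.
  · intro e he c hc h0
    obtain ⟨d, hd, hd0, N, H | H | H⟩ := hp.trichotomy hq he h0
    · exact ⟨d, hd, hd0, N, H⟩
    · have : d ≤ sSup (S p q) := le_sSup ⟨_, half_pos he, N, H⟩
      exact absurd ((disjoint_compl_right.mono (this.trans le_sup_left)
        (hd.trans hc)).eq_bot_of_self) hd0
    · have : d ≤ sSup (S q p) := le_sSup ⟨_, half_pos he, N, H⟩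
      exact absurd ((disjoint_compl_right.mono (this.trans le_sup_right)
        (hd.trans hc)).eq_bot_of_self) hd0

end LocalCharacterisations

/-! ### Ring identities for the conditional rational numbers -/

namespace CondSet.gen

variable {A : Type u} [CompleteBooleanAlgebra A]

/-- The pattern for all identities below: shrink until every variable has a rational value; both
sides then take the values of the corresponding expressions in ℚ. -/
theorem add_assoc (x y z : (gen A ℚ).obj ⊤) :
    (condRat A).add.toFun ((condRat A).add.toFun (x, y), z) =
      (condRat A).add.toFun (x, (condRat A).add.toFun (y, z)) := by
  refine gen.eq_of_dense fun d hd0 => ?_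
  obtain ⟨d0, hd0, h00, a, hx⟩ := exists_val x.2 hd0
  obtain ⟨d1, hd1, h01, b, hy⟩ := exists_val y.2 h00
  replace hx := hd1.trans hx
  obtain ⟨d2, hd2, h02, c, hz⟩ := exists_val z.2 h01
  replace hx := hd2.trans hx
  replace hy := hd2.trans hy
  have e : (((a + b) + c) : ℚ) = (a + (b + c)) := _root_.add_assoc a b c
  exact ⟨d2, (hd2.trans (hd1.trans hd0)), h02, (a + (b + c)), (gen.le_map₂ (fun x y : ℚ => x + y) (gen.le_map₂ (fun x y : ℚ => x + y) hx hy) hz).trans_eq (congrArg _ e),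
    (gen.le_map₂ (fun x y : ℚ => x + y) hx (gen.le_map₂ (fun x y : ℚ => x + y) hy hz))⟩

theorem add_comm (x y : (gen A ℚ).obj ⊤) :
    (condRat A).add.toFun (x, y) =
      (condRat A).add.toFun (y, x) := by
  refine gen.eq_of_dense fun d hd0 => ?_
  obtain ⟨d0, hd0, h00, a, hx⟩ := exists_val x.2 hd0
  obtain ⟨d1, hd1, h01, b, hy⟩ := exists_val y.2 h00
  replace hx := hd1.trans hx
  have e : ((a + b) : ℚ) = (b + a) := _root_.add_comm a b
  exact ⟨d1, (hd1.trans hd0), h01, (b + a), (gen.le_map₂ (fun x y : ℚ => x + y) hx hy).trans_eq (congrArg _ e),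
    (gen.le_map₂ (fun x y : ℚ => x + y) hy hx)⟩

theorem zero_add (x : (gen A ℚ).obj ⊤) :
    (condRat A).add.toFun (gen.const 0, x) =
      x := by
  refine gen.eq_of_dense fun d hd0 => ?_
  obtain ⟨d0, hd0, h00, a, hx⟩ := exists_val x.2 hd0
  have e : ((0 + a) : ℚ) = a := _root_.zero_add a
  exact ⟨d0, hd0, h00, a, (gen.le_map₂ (fun x y : ℚ => x + y) (gen.le_const (0 : ℚ) _) hx).trans_eq (congrArg _ e),
    hx⟩

theorem mul_assoc (x y z : (gen A ℚ).obj ⊤) :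
    (condRat A).mul.toFun ((condRat A).mul.toFun (x, y), z) =
      (condRat A).mul.toFun (x, (condRat A).mul.toFun (y, z)) := by
  refine gen.eq_of_dense fun d hd0 => ?_
  obtain ⟨d0, hd0, h00, a, hx⟩ := exists_val x.2 hd0
  obtain ⟨d1, hd1, h01, b, hy⟩ := exists_val y.2 h00
  replace hx := hd1.trans hx
  obtain ⟨d2, hd2, h02, c, hz⟩ := exists_val z.2 h01
  replace hx := hd2.trans hx
  replace hy := hd2.trans hy
  have e : (((a * b) * c) : ℚ) = (a * (b * c)) := _root_.mul_assoc a b c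
  exact ⟨d2, (hd2.trans (hd1.trans hd0)), h02, (a * (b * c)), (gen.le_map₂ (fun x y : ℚ => x * y) (gen.le_map₂ (fun x y : ℚ => x * y) hx hy) hz).trans_eq (congrArg _ e),
    (gen.le_map₂ (fun x y : ℚ => x * y) hx (gen.le_map₂ (fun x y : ℚ => x * y) hy hz))⟩

theorem mul_comm (x y : (gen A ℚ).obj ⊤) :
    (condRat A).mul.toFun (x, y) =
      (condRat A).mul.toFun (y, x) := by
  refine gen.eq_of_dense fun d hd0 => ?_
  obtain ⟨d0, hd0, h00, a, hx⟩ := exists_val x.2 hd0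
  obtain ⟨d1, hd1, h01, b, hy⟩ := exists_val y.2 h00
  replace hx := hd1.trans hx
  have e : ((a * b) : ℚ) = (b * a) := _root_.mul_comm a b
  exact ⟨d1, (hd1.trans hd0), h01, (b * a), (gen.le_map₂ (fun x y : ℚ => x * y) hx hy).trans_eq (congrArg _ e),
    (gen.le_map₂ (fun x y : ℚ => x * y) hy hx)⟩

theorem one_mul (x : (gen A ℚ).obj ⊤) :
    (condRat A).mul.toFun (gen.const 1, x) =
      x := by
  refine gen.eq_of_dense fun d hd0 => ?_
  obtain ⟨d0, hd0, h00, a, hx⟩ := exists_val x.2 hd0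
  have e : ((1 * a) : ℚ) = a := _root_.one_mul a
  exact ⟨d0, hd0, h00, a, (gen.le_map₂ (fun x y : ℚ => x * y) (gen.le_const (1 : ℚ) _) hx).trans_eq (congrArg _ e),
    hx⟩

theorem mul_add (x y z : (gen A ℚ).obj ⊤) :
    (condRat A).mul.toFun (x, (condRat A).add.toFun (y, z)) =
      (condRat A).add.toFun ((condRat A).mul.toFun (x, y), (condRat A).mul.toFun (x, z)) := by
  refine gen.eq_of_dense fun d hd0 => ?_
  obtain ⟨d0, hd0, h00, a, hx⟩ := exists_val x.2 hd0
  obtain ⟨d1, hd1, h01, b, hy⟩ := exists_val y.2 h00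
  replace hx := hd1.trans hx
  obtain ⟨d2, hd2, h02, c, hz⟩ := exists_val z.2 h01
  replace hx := hd2.trans hx
  replace hy := hd2.trans hy
  have e : ((a * (b + c)) : ℚ) = ((a * b) + (a * c)) := _root_.mul_add a b c
  exact ⟨d2, (hd2.trans (hd1.trans hd0)), h02, ((a * b) + (a * c)), (gen.le_map₂ (fun x y : ℚ => x * y) hx (gen.le_map₂ (fun x y : ℚ => x + y) hy hz)).trans_eq (congrArg _ e),
    (gen.le_map₂ (fun x y : ℚ => x + y) (gen.le_map₂ (fun x y : ℚ => x * y) hx hy) (gen.le_map₂ (fun x y : ℚ => x * y) hx hz))⟩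

theorem add_mul (x y z : (gen A ℚ).obj ⊤) :
    (condRat A).mul.toFun ((condRat A).add.toFun (x, y), z) =
      (condRat A).add.toFun ((condRat A).mul.toFun (x, z), (condRat A).mul.toFun (y, z)) := by
  refine gen.eq_of_dense fun d hd0 => ?_
  obtain ⟨d0, hd0, h00, a, hx⟩ := exists_val x.2 hd0
  obtain ⟨d1, hd1, h01, b, hy⟩ := exists_val y.2 h00
  replace hx := hd1.trans hx
  obtain ⟨d2, hd2, h02, c, hz⟩ := exists_val z.2 h01
  replace hx := hd2.trans hx
  replace hy := hd2.trans hy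
  have e : (((a + b) * c) : ℚ) = ((a * c) + (b * c)) := _root_.add_mul a b c
  exact ⟨d2, (hd2.trans (hd1.trans hd0)), h02, ((a * c) + (b * c)), (gen.le_map₂ (fun x y : ℚ => x * y) (gen.le_map₂ (fun x y : ℚ => x + y) hx hy) hz).trans_eq (congrArg _ e),
    (gen.le_map₂ (fun x y : ℚ => x + y) (gen.le_map₂ (fun x y : ℚ => x * y) hx hz) (gen.le_map₂ (fun x y : ℚ => x * y) hy hz))⟩

theorem zero_mul (x : (gen A ℚ).obj ⊤) :
    (condRat A).mul.toFun (gen.const 0, x) =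
      gen.const 0 := by
  refine gen.eq_of_dense fun d hd0 => ?_
  obtain ⟨d0, hd0, h00, a, hx⟩ := exists_val x.2 hd0
  have e : ((0 * a) : ℚ) = 0 := MulZeroClass.zero_mul a
  exact ⟨d0, hd0, h00, 0, (gen.le_map₂ (fun x y : ℚ => x * y) (gen.le_const (0 : ℚ) _) hx).trans_eq (congrArg _ e),
    (gen.le_const (0 : ℚ) _)⟩

/-- Negation is expressed as multiplication by the constant −1, so no further operation has to be
shown compatible with `∼`. -/
theorem neg_add_cancel (x : (gen A ℚ).obj ⊤) :
    (condRat A).add.toFun ((condRat A).mul.toFun (gen.const (-1), x), x) =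
      gen.const 0 := by
  refine gen.eq_of_dense fun d hd0 => ?_
  obtain ⟨d0, hd0, h00, a, hx⟩ := exists_val x.2 hd0
  have e : ((((-1) * a) + a) : ℚ) = 0 := by ring
  exact ⟨d0, hd0, h00, 0, (gen.le_map₂ (fun x y : ℚ => x + y) (gen.le_map₂ (fun x y : ℚ => x * y) (gen.le_const (-1 : ℚ) _) hx) hx).trans_eq (congrArg _ e),
    (gen.le_const (0 : ℚ) _)⟩

end CondSet.gen

/-! ### The conditional real numbers form a conditionally ordered field -/

section OrderedField

variable {A : Type u} [CompleteBooleanAlgebra A]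

/-- The conditional real number represented by a conditional Cauchy sequence. -/
noncomputable def condReal.mk (q : Hom (condNat A) (gen A ℚ)) (hq : IsCondCauchy q) :
    (condReal A).carrier.obj ⊤ :=
  quotient.mk condCauchy.rel_isEquivalence ⟨q, (condCauchy A).mem_at_top.2 hq⟩

/-- The constant conditional sequence. -/
noncomputable def constSeq (x : (gen A ℚ).obj ⊤) : Hom (condNat A) (gen A ℚ) :=
  Hom.mk' (fun _ => x) (fun _ _ _ _ => rfl)

theorem isCondCauchy_constSeq (x : (gen A ℚ).obj ⊤) : IsCondCauchy (constSeq x) :=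
  isCondCauchy_iff.2 fun e he c hc => ⟨c, le_rfl, hc, 0, fun _ _ _ _ d _ hd0 s t hs ht => by
    obtain rfl := val_unique x.2 hd0 hs ht
    simpa using he⟩

theorem seqOp_val {f : ℚ → ℚ → ℚ} {p q : Hom (condNat A) (gen A ℚ)} {n : (condNat A).obj ⊤} {c : A}
    (hc : c ≠ ⊥) {z : ℚ} (hz : c ≤ (((seqOp (gen.map₂ A f)).toFun (p, q)).toFun n).1 z) :
    ∃ d ≤ c, d ≠ ⊥ ∧ ∃ s t, d ≤ (p.toFun n).1 s ∧ d ≤ (q.toFun n).1 t ∧ z = f s t :=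
  gen.map₂_val f hc hz

namespace condReal

variable {p q r : Hom (condNat A) (gen A ℚ)} {hp : IsCondCauchy p} {hq : IsCondCauchy q}
  {hr : IsCondCauchy r} {b : A}

theorem exists_mk (x : (condReal A).carrier.obj ⊤) : ∃ q hq, x = mk q hq := by
  obtain ⟨y, rfl⟩ := quotient.mk_surjective condCauchy.rel_isEquivalence x
  exact ⟨y.1, condCauchy.isCondCauchy y, rfl⟩

/-- Cauchy sequences form a stable set, so a glued sequence is again Cauchy. It serves to extend a
relation known only on `b` to all of ⊤. -/
theorem exists_mix_seq (b : A) (hp : IsCondCauchy p) (hq : IsCondCauchy q) :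
    ∃ z, ∃ _ : IsCondCauchy z, (condSeq A).γ b z = (condSeq A).γ b p ∧
      (condSeq A).γ bᶜ z = (condSeq A).γ bᶜ q := by
  obtain ⟨z, h1, h2⟩ := (condSeq A).exists_mix b p q
  exact ⟨z, (condCauchy A).mix b hp hq h1 h2, h1, h2⟩

/-- Classes agree on `b` when some sequence that agrees with `p` on `b` is equivalent to `q`
everywhere. Given `LocEq b p q`, such a sequence is `p` on `b` glued to `q` on the complement. -/
theorem γ_mk :
    (condReal A).carrier.γ b (mk p hp) = (condReal A).carrier.γ b (mk q hq) ↔ LocEq b p q := by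
  refine (quotient.γ_mk_eq condCauchy.rel_isEquivalence).trans ⟨?_, fun h => ?_⟩
  · rintro ⟨z, hz, hzq⟩
    exact (LocEq.of_γ (congrArg Subtype.val hz)).symm.trans
      ((condEquiv_iff_locEq.1 hzq).mono le_top)
  · obtain ⟨z, hz, h1, h2⟩ := exists_mix_seq b hp hq
    refine ⟨⟨z, (condCauchy A).mem_at_top.2 hz⟩, Subtype.ext h1, condEquiv_iff_locEq.2 ?_⟩
    exact fun e he => (((LocEq.of_γ h1).trans h) e he).of_compl (LocEq.of_γ h2 e he)

theorem mk_eq : mk p hp = mk q hq ↔ LocEq ⊤ p q := by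
  rw [← γ_mk (hp := hp) (hq := hq), (condReal A).carrier.identity, (condReal A).carrier.identity]

/-- The order asks only for some representatives; changing them is harmless because `LocEq` implies
`LocLe` in both directions. -/
theorem le_mk : (mk p hp, mk q hq) ∈ (condReal A).le.primal ↔ LocLe ⊤ p q := by
  constructor
  · rintro ⟨x, y, hx, hy, h⟩
    have h1 : LocEq ⊤ p x.1 := mk_eq (hp := hp) (hq := condCauchy.isCondCauchy x).1 hx
    have h2 : LocEq ⊤ q y.1 := mk_eq (hp := hq) (hq := condCauchy.isCondCauchy y).1 hy
    exact h1.le.trans ((eventuallyLe_iff_locLe.1 h).trans h2.symm.le)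
  · exact fun h => ⟨_, _, rfl, rfl, eventuallyLe_iff_locLe.2 h⟩

theorem le_γ_mk : (condReal A).le.le b ((condReal A).carrier.γ b (mk p hp))
    ((condReal A).carrier.γ b (mk q hq)) ↔ LocLe b p q := by
  constructor
  · rintro ⟨⟨x, y⟩, h, e⟩
    obtain ⟨u, hu, rfl⟩ := exists_mk x
    obtain ⟨v, hv, rfl⟩ := exists_mk y
    have h1 : LocEq b u p := (γ_mk (hp := hu) (hq := hp)).1 (congrArg Prod.fst e)
    have h2 : LocEq b v q := (γ_mk (hp := hv) (hq := hq)).1 (congrArg Prod.snd e)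
    exact h1.symm.le.trans (LocLe.trans (fun e he => (le_mk.1 h e he).mono le_top fun _ _ h => h)
      h2.le)
  · intro h
    -- The glued sequence is `p` on `b` and `q` off `b`, hence at most `q` everywhere.
    obtain ⟨z, hz, h1, h2⟩ := exists_mix_seq b hp hq
    refine ⟨(mk z hz, mk q hq), le_mk.2 fun e he => ?_,
      Prod.ext ((γ_mk (hp := hz) (hq := hp)).2 (LocEq.of_γ h1)) rfl⟩
    exact (((LocEq.of_γ h1).le.trans h) e he).of_compl ((LocEq.of_γ h2).le e he)

/-- The strict order only says "at most, and nowhere equal"; `locLt_of_locLe` turns this into the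
local gap on which compatibility with `+` and `·` rests. -/
theorem lt_γ_mk : (condReal A).le.lt b ((condReal A).carrier.γ b (mk p hp))
    ((condReal A).carrier.γ b (mk q hq)) ↔ LocLt b p q := by
  have hres : ∀ c ≤ b, ((condReal A).carrier.res c ((condReal A).carrier.γ b (mk p hp)) =
      (condReal A).carrier.res c ((condReal A).carrier.γ b (mk q hq)) ↔ LocEq c p q) := by
    intro c hc
    rw [res_γ _ hc, res_γ _ hc, γ_mk]
  constructor
  · rintro ⟨h, h'⟩
    exact locLt_of_locLe hp hq (le_γ_mk.1 h) fun c hc e => h' c hc ((hres c hc).2 e)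
  · exact fun h => ⟨le_γ_mk.2 h.le, fun c hc e => h.eq_bot hc ((hres c hc).1 e).symm.le⟩

theorem lt_mk : (condReal A).le.lt ⊤ (mk p hp) (mk q hq) ↔ LocLt ⊤ p q := by
  rw [← lt_γ_mk (hp := hp) (hq := hq), (condReal A).carrier.identity,
    (condReal A).carrier.identity]

theorem isTotalOrder : (condReal A).le.IsTotalOrder where
  refl x := by
    obtain ⟨p, hp, rfl⟩ := exists_mk x
    exact Rel.le_top.2 (le_mk.2 (LocEq.of_γ rfl).le)
  trans x y z h h' := by
    obtain ⟨p, hp, rfl⟩ := exists_mk x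
    obtain ⟨q, hq, rfl⟩ := exists_mk y
    obtain ⟨r, hr, rfl⟩ := exists_mk z
    exact Rel.le_top.2 (le_mk.2 ((le_mk.1 (Rel.le_top.1 h)).trans (le_mk.1 (Rel.le_top.1 h'))))
  antisymm x y h h' := by
    obtain ⟨p, hp, rfl⟩ := exists_mk x
    obtain ⟨q, hq, rfl⟩ := exists_mk y
    exact mk_eq.2 ((le_mk.1 (Rel.le_top.1 h)).antisymm (le_mk.1 (Rel.le_top.1 h')))
  total x y := by
    obtain ⟨p, hp, rfl⟩ := exists_mk x
    obtain ⟨q, hq, rfl⟩ := exists_mk y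
    obtain ⟨a, b, c, h, h1, h2, h3⟩ := exists_partition hp hq
    exact ⟨a, b, c, h, lt_γ_mk.2 h1, lt_γ_mk.2 h2, γ_mk.2 h3⟩

/-- The embedding of the conditional rational numbers as classes of constant sequences. -/
noncomputable def ofRat (x : (gen A ℚ).obj ⊤) : (condReal A).carrier.obj ⊤ :=
  mk (constSeq x) (isCondCauchy_constSeq x)

theorem mul_mk : (condReal A).mul.toFun (mk p hp, mk q hq) =
    mk ((seqOp (gen.map₂ A fun x y : ℚ => x * y)).toFun (p, q))
      (IsCondCauchy.op isGoodOp_mul hp hq) := rfl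

/-- Suffices for the ring axioms, which hold term by term before passing to classes. -/
theorem mk_congr {x y : (condCauchy A).toCondSet.obj ⊤} (h : ∀ n, x.1.toFun n = y.1.toFun n) :
    quotient.mk condCauchy.rel_isEquivalence x = quotient.mk condCauchy.rel_isEquivalence y :=
  congrArg _ (Subtype.ext (Fun.ext (funext h)))

theorem ofRat_add (x y : (gen A ℚ).obj ⊤) : ofRat ((condRat A).add.toFun (x, y)) =
    (condReal A).add.toFun (ofRat x, ofRat y) := rfl

theorem ofRat_mul (x y : (gen A ℚ).obj ⊤) : ofRat ((condRat A).mul.toFun (x, y)) =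
    (condReal A).mul.toFun (ofRat x, ofRat y) := rfl

/-- The ring of conditional real numbers. -/
noncomputable abbrev commRing : CommRing ((condReal A).carrier.obj ⊤) :=
  letI : Add ((condReal A).carrier.obj ⊤) := ⟨fun x y => (condReal A).add.toFun (x, y)⟩
  letI : Mul ((condReal A).carrier.obj ⊤) := ⟨fun x y => (condReal A).mul.toFun (x, y)⟩
  letI : Zero ((condReal A).carrier.obj ⊤) := ⟨ofRat (gen.const 0)⟩
  letI : One ((condReal A).carrier.obj ⊤) := ⟨ofRat (gen.const 1)⟩
  letI : Neg ((condReal A).carrier.obj ⊤) :=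
    ⟨fun x => (condReal A).mul.toFun (ofRat (gen.const (-1)), x)⟩
  { nsmul := nsmulRec
    zsmul := zsmulRec
    add_assoc x y z := by
      obtain ⟨p, hp, rfl⟩ := exists_mk x
      obtain ⟨q, hq, rfl⟩ := exists_mk y
      obtain ⟨r, hr, rfl⟩ := exists_mk z
      exact mk_congr fun n => gen.add_assoc _ _ _
    add_comm x y := by
      obtain ⟨p, hp, rfl⟩ := exists_mk x
      obtain ⟨q, hq, rfl⟩ := exists_mk y
      exact mk_congr fun n => gen.add_comm _ _
    zero_add x := by
      obtain ⟨p, hp, rfl⟩ := exists_mk x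
      exact mk_congr fun n => gen.zero_add _
    add_zero x := by
      obtain ⟨p, hp, rfl⟩ := exists_mk x
      exact mk_congr fun n => (gen.add_comm _ _).trans (gen.zero_add _)
    mul_assoc x y z := by
      obtain ⟨p, hp, rfl⟩ := exists_mk x
      obtain ⟨q, hq, rfl⟩ := exists_mk y
      obtain ⟨r, hr, rfl⟩ := exists_mk z
      exact mk_congr fun n => gen.mul_assoc _ _ _
    mul_comm x y := by
      obtain ⟨p, hp, rfl⟩ := exists_mk x
      obtain ⟨q, hq, rfl⟩ := exists_mk y
      exact mk_congr fun n => gen.mul_comm _ _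
    one_mul x := by
      obtain ⟨p, hp, rfl⟩ := exists_mk x
      exact mk_congr fun n => gen.one_mul _
    mul_one x := by
      obtain ⟨p, hp, rfl⟩ := exists_mk x
      exact mk_congr fun n => (gen.mul_comm _ _).trans (gen.one_mul _)
    left_distrib x y z := by
      obtain ⟨p, hp, rfl⟩ := exists_mk x
      obtain ⟨q, hq, rfl⟩ := exists_mk y
      obtain ⟨r, hr, rfl⟩ := exists_mk z
      exact mk_congr fun n => gen.mul_add _ _ _
    right_distrib x y z := by
      obtain ⟨p, hp, rfl⟩ := exists_mk x
      obtain ⟨q, hq, rfl⟩ := exists_mk y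
      obtain ⟨r, hr, rfl⟩ := exists_mk z
      exact mk_congr fun n => gen.add_mul _ _ _
    zero_mul x := by
      obtain ⟨p, hp, rfl⟩ := exists_mk x
      exact mk_congr fun n => gen.zero_mul _
    mul_zero x := by
      obtain ⟨p, hp, rfl⟩ := exists_mk x
      exact mk_congr fun n => (gen.mul_comm _ _).trans (gen.zero_mul _)
    neg_add_cancel x := by
      obtain ⟨p, hp, rfl⟩ := exists_mk x
      exact mk_congr fun n => gen.neg_add_cancel _ }

/-- Otherwise trichotomy against the zero sequence would leave closeness for every tolerance, so `p`
would represent 0 on `c`. -/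
theorem apart_mk_zero (h : Apart (mk p hp) (ofRat (gen.const 0))) (c : A) (hc : c ≠ ⊥) :
    ∃ d ≤ c, d ≠ ⊥ ∧ ∃ e : ℚ, 0 < e ∧ ∃ N : ℕ, ∀ n ≥ N, ∀ d' ≤ d, d' ≠ ⊥ → ∀ s,
      d' ≤ (p.toFun (gen.const n)).1 s → e < |s| := by
  have h0 : ∀ d, d ≠ ⊥ → ¬ LocEq d p (constSeq (gen.const 0)) := fun d hd e =>
    hd (h d (γ_mk.2 e))
  by_contra hn
  refine h0 c hc fun e he c' hc' h0' => ?_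
  obtain ⟨d, hd, hd0, N, H | H | H⟩ :=
    hp.trichotomy (isCondCauchy_constSeq (gen.const 0)) he h0'
  · exact ⟨d, hd, hd0, N, H⟩
  · refine absurd ⟨d, hd.trans hc', hd0, _, half_pos he, N, fun n hn d' hd' hd0' s hs => ?_⟩ hn
    have := H n hn d' hd' hd0' s 0 hs (gen.le_const 0 d')
    exact lt_abs.2 (Or.inr (by linarith))
  · refine absurd ⟨d, hd.trans hc', hd0, _, half_pos he, N, fun n hn d' hd' hd0' s hs => ?_⟩ hn
    have := H n hn d' hd' hd0' 0 s (gen.le_const 0 d') hs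
    exact lt_abs.2 (Or.inl (by linarith))

/-- The pointwise inverse of a sequence. -/
noncomputable def _root_.invSeq (p : Hom (condNat A) (gen A ℚ)) : Hom (condNat A) (gen A ℚ) :=
  -- Terms with value 0 are sent to 0 by the convention `0⁻¹ = 0`. When the class of `p` is apart
  -- from 0, this occurs only before the local starting index.
  Hom.mk' (fun n => (gen.map A fun x : ℚ => x⁻¹).toFun (p.toFun n))
    (fun _ _ _ h => (gen.map A fun x : ℚ => x⁻¹).γ_eq (p.γ_eq h))

theorem isCondCauchy_invSeq (h : Apart (mk p hp) (ofRat (gen.const 0))) :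
    IsCondCauchy (invSeq p) := by
  refine isCondCauchy_iff.2 fun e he c hc => ?_
  obtain ⟨d, hd, hd0, η, hη, N, H⟩ := apart_mk_zero h c hc
  -- The tolerance is dictated by `t⁻¹ - s⁻¹ = (s - t) / (t * s)` with `|s|, |t| > η`.
  obtain ⟨d', hd', hd0', M, H'⟩ := isCondCauchy_iff.1 hp (e * (η * η)) (by positivity) d hd0
  refine ⟨d', hd'.trans hd, hd0', max N M, fun m hm n hn c₁ hc₁ hc₁0 s t hs ht => ?_⟩
  obtain ⟨c₂, hc₂, hc₂0, s, hs', rfl⟩ := gen.map_val _ hc₁0 hs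
  obtain ⟨c₃, hc₃, hc₃0, t, ht', rfl⟩ := gen.map_val _ hc₂0 (hc₂.trans ht)
  have h3 : c₃ ≤ d' := (hc₃.trans hc₂).trans hc₁
  have a1 := H m ((le_max_left N M).trans hm) c₃ (h3.trans hd') hc₃0 s (hc₃.trans hs')
  have a2 := H n ((le_max_left N M).trans hn) c₃ (h3.trans hd') hc₃0 t ht'
  have a3 := H' m ((le_max_right N M).trans hm) n ((le_max_right N M).trans hn) c₃ h3 hc₃0 s t
    (hc₃.trans hs') ht'
  have s0 : s ≠ 0 := abs_pos.1 (hη.trans a1)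
  have t0 : t ≠ 0 := abs_pos.1 (hη.trans a2)
  rw [inv_sub_inv t0 s0, abs_div, abs_mul, abs_sub_comm, div_lt_iff₀ (by positivity)]
  refine a3.trans ?_
  have : η * η < |t| * |s| := by gcongr
  gcongr

/-- The termwise product is exactly 1 from a locally chosen index on, which suffices for equality of
classes though not of sequences. -/
theorem mul_invSeq (h : Apart (mk p hp) (ofRat (gen.const 0))) :
    (condReal A).mul.toFun (mk p hp, mk (invSeq p) (isCondCauchy_invSeq h)) =
      ofRat (gen.const 1) := by
  refine (mul_mk.trans (mk_eq.2 fun e he c _ hc => ?_))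
  obtain ⟨d, hd, hd0, η, hη, N, H⟩ := apart_mk_zero h c hc
  refine ⟨d, hd, hd0, N, fun n hn c₁ hc₁ hc₁0 s t hs ht => ?_⟩
  obtain rfl := gen.const_val hc₁0 ht
  obtain ⟨c₂, hc₂, hc₂0, x, y, hx, hy, rfl⟩ := seqOp_val hc₁0 hs
  obtain rfl := val_unique ((gen.map A fun x : ℚ => x⁻¹).toFun (p.toFun (gen.const n))).2 hc₂0
    (gen.le_map (fun x : ℚ => x⁻¹) hx) hy
  have x0 : x ≠ 0 := abs_pos.1 (hη.trans (H n hn c₂ (hc₂.trans hc₁) hc₂0 x hx))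
  simpa [x0] using he

theorem γ_ofRat {x y : (gen A ℚ).obj ⊤} {b : A} : (condReal A).carrier.γ b (ofRat x) =
    (condReal A).carrier.γ b (ofRat y) ↔ (gen A ℚ).γ b x = (gen A ℚ).γ b y := by
  refine γ_mk.trans ⟨fun h => gen_γ_eq_of_dense fun c hc h0 => ?_,
    fun h => LocEq.of_γ (Hom.restrict_eq_iff.2 fun _ => h)⟩
  obtain ⟨d, hd, hd0, s, t, hs, ht⟩ := exists_vals x y h0
  refine ⟨d, hd, hd0, s, hs, ?_⟩
  by_contra hn
  have hst : s ≠ t := fun e => hn (e ▸ ht)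
  -- For constant sequences the distance of the values is itself a tolerance, and it would have to
  -- be smaller than itself.
  obtain ⟨d', hd', hd0', N, H⟩ := h |s - t| (abs_pos.2 (sub_ne_zero.2 hst)) d (hd.trans hc) hd0
  exact lt_irrefl _ (H N le_rfl d' le_rfl hd0' s t (hd'.trans hs) (hd'.trans ht))

theorem ofRat_le {x y : (gen A ℚ).obj ⊤} : (ofRat x, ofRat y) ∈ (condReal A).le.primal ↔
    (x, y) ∈ (condRat A).le.primal := by
  refine le_mk.trans ⟨fun h s t h0 => ?_, fun h e he => ?_⟩
  · by_contra hn
    -- With tolerance `s - t` the assumption would read `s < s`.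
    obtain ⟨d, hd, hd0, N, H⟩ := h (s - t) (by linarith) _ le_top h0
    have := H N le_rfl d le_rfl hd0 s t (hd.trans inf_le_left) (hd.trans inf_le_right)
    linarith
  · refine LocEv.of_forall fun n c _ h0 s t hs ht => ?_
    have : s ≤ t := gen.rel_val (hR := ⟨0, 0, le_rfl⟩) h h0 hs ht
    linarith

theorem apart_one_zero : Apart (ofRat (A := A) (gen.const 1)) (ofRat (gen.const 0)) := by
  intro b hb
  by_contra h0
  have := gen.le_of_γ (γ_ofRat.1 hb) le_rfl (gen.le_const (1 : ℚ) b)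
  exact one_ne_zero (gen.const_val h0 this)

/-- A factor of `1` is apart from `0`. -/
theorem apart_of_mul_eq_one {x y : (condReal A).carrier.obj ⊤}
    (h : (condReal A).mul.toFun (x, y) = ofRat (gen.const 1)) : Apart y (ofRat (gen.const 0)) := by
  intro b hb
  refine apart_one_zero b ?_
  rw [← h, (condReal A).mul.γ_eq (x := (x, y)) (y := (x, ofRat (gen.const 0)))
    (Prod.ext rfl hb)]
  exact congrArg _ (commRing.mul_zero x)

theorem add_lt_add {x y : (condReal A).carrier.obj ⊤} (z : (condReal A).carrier.obj ⊤)
    (h : (condReal A).le.lt ⊤ x y) :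
    (condReal A).le.lt ⊤ ((condReal A).add.toFun (x, z)) ((condReal A).add.toFun (y, z)) := by
  obtain ⟨p, hp, rfl⟩ := exists_mk x
  obtain ⟨q, hq, rfl⟩ := exists_mk y
  obtain ⟨r, hr, rfl⟩ := exists_mk z
  refine (lt_mk (hp := IsCondCauchy.op isGoodOp_add hp hr)
    (hq := IsCondCauchy.op isGoodOp_add hq hr)).2 fun c hc h0 => ?_
  obtain ⟨d, hd, hd0, e, he, N, H⟩ := lt_mk.1 h c hc h0
  refine ⟨d, hd, hd0, e, he, N, fun n hn c₁ hc₁ hc₁0 s t hs ht => ?_⟩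
  obtain ⟨c₂, hc₂, hc₂0, x, z, hx, hz, rfl⟩ := seqOp_val hc₁0 hs
  obtain ⟨c₃, hc₃, hc₃0, y, z', hy, hz', rfl⟩ := seqOp_val hc₂0 (hc₂.trans ht)
  -- Both sums use the same term of `r`, so the gap is unchanged.
  obtain rfl := val_unique (r.toFun (gen.const n)).2 hc₃0 (hc₃.trans hz) hz'
  have := H n hn c₃ ((hc₃.trans hc₂).trans hc₁) hc₃0 x y (hc₃.trans hx) hy
  linarith

theorem mul_pos {x y : (condReal A).carrier.obj ⊤}
    (h : (condReal A).le.lt ⊤ (ofRat (gen.const 0)) x)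
    (h' : (condReal A).le.lt ⊤ (ofRat (gen.const 0)) y) :
    (condReal A).le.lt ⊤ (ofRat (gen.const 0)) ((condReal A).mul.toFun (x, y)) := by
  obtain ⟨p, hp, rfl⟩ := exists_mk x
  obtain ⟨q, hq, rfl⟩ := exists_mk y
  refine (lt_mk (hp := isCondCauchy_constSeq (gen.const 0))
    (hq := IsCondCauchy.op isGoodOp_mul hp hq)).2 fun c hc h0 => ?_
  obtain ⟨d, hd, hd0, e, he, N, H⟩ := lt_mk.1 h c hc h0
  obtain ⟨d', hd', hd0', e', he', N', H'⟩ := lt_mk.1 h' d (hd.trans hc) hd0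
  refine ⟨d', hd'.trans hd, hd0', e * e', _root_.mul_pos he he', max N N',
    fun n hn c₁ hc₁ hc₁0 s t hs ht => ?_⟩
  obtain rfl := gen.const_val hc₁0 hs
  obtain ⟨c₂, hc₂, hc₂0, x, y, hx, hy, rfl⟩ := seqOp_val hc₁0 ht
  have h1 := H n ((le_max_left _ _).trans hn) c₂ ((hc₂.trans hc₁).trans hd') hc₂0 0 x
    (gen.le_const 0 c₂) hx
  have h2 := H' n ((le_max_right _ _).trans hn) c₂ (hc₂.trans hc₁) hc₂0 0 y
    (gen.le_const 0 c₂) hy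
  have h1 : e < x := by linarith
  have h2 : e' < y := by linarith
  rw [zero_add]
  gcongr

theorem isOrderedField : (condReal A).IsOrderedField where
  total := isTotalOrder
  field := by
    refine ⟨commRing, fun _ _ => rfl, fun _ _ => rfl, apart_one_zero, fun x hx => ?_,
      fun x y z h => add_lt_add z h, fun x y h h' => mul_pos h h'⟩
    obtain ⟨p, hp, rfl⟩ := exists_mk x
    have h1 := mul_invSeq hx
    exact ⟨_, apart_of_mul_eq_one h1, h1, (commRing.mul_comm _ _).trans h1⟩

end condReal
end OrderedField

/-! ### The image of the conditional rationals -/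

section RationalSubfield

namespace condReal

/-- The image of the conditional rational numbers in the conditional real numbers. -/
noncomputable def rationals (A : Type u) [CompleteBooleanAlgebra A] :
    (condReal A).carrier.Stable where
  primal := Set.range ofRat
  nonempty := ⟨_, gen.const 0, rfl⟩
  stable I a ha s hs x hx := by
    choose y hy using hs
    -- Glue the preimages in 𝐐; since the embedding is local, the image of the result agrees with
    -- `x` on every piece.
    obtain ⟨z, hz, -⟩ := (gen A ℚ).stability I a ha (fun i => (gen A ℚ).γ (a i) (y i))
    exact ⟨z, CondSet.eq_of_partition _ ha fun i =>
      (γ_ofRat.2 (hz i)).trans ((congrArg _ (hy i)).trans (hx i).symm)⟩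

variable {A : Type u} [CompleteBooleanAlgebra A]

theorem isSubstructure_rationals : (condReal A).IsSubstructure (rationals A) where
  add_mem := by
    rintro _ ⟨x, rfl⟩ _ ⟨y, rfl⟩
    exact ⟨(condRat A).add.toFun (x, y), ofRat_add x y⟩
  mul_mem := by
    rintro _ ⟨x, rfl⟩ _ ⟨y, rfl⟩
    exact ⟨(condRat A).mul.toFun (x, y), ofRat_mul x y⟩
  le_nonempty := ⟨_, ⟨gen.const 0, rfl⟩, _, ⟨gen.const 0, rfl⟩, Rel.le_top.1 (isTotalOrder.refl _)⟩

theorem mem_rationals (x : (gen A ℚ).obj ⊤) : ofRat x ∈ (rationals A).at ⊤ :=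
  (rationals A).mem_at_top.2 ⟨x, rfl⟩

theorem exists_ofRat (x : (rationals A).toCondSet.obj ⊤) : ∃ y, x = ⟨ofRat y, mem_rationals y⟩ := by
  obtain ⟨y, hy⟩ := (rationals A).mem_at_top.1 x.2
  exact ⟨y, Subtype.ext hy.symm⟩

/-- The image of the conditional rational numbers as a subring. -/
noncomputable def rationalSubring (A : Type u) [CompleteBooleanAlgebra A] :
    letI := commRing (A := A)
    Subring ((condReal A).carrier.obj ⊤) :=
  letI := commRing (A := A)
  { carrier := (rationals A).at ⊤
    mul_mem' := by
      intro x y hx hy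
      exact (rationals A).mem_at_top.2 (isSubstructure_rationals.mul_mem _
        ((rationals A).mem_at_top.1 hx) _ ((rationals A).mem_at_top.1 hy))
    one_mem' := mem_rationals _
    add_mem' := by
      intro x y hx hy
      exact (rationals A).mem_at_top.2 (isSubstructure_rationals.add_mem _
        ((rationals A).mem_at_top.1 hx) _ ((rationals A).mem_at_top.1 hy))
    zero_mem' := mem_rationals _
    neg_mem' := by
      intro x hx
      -- Negation in `commRing` is multiplication by the rational −1, so closure under products
      -- suffices.
      exact (rationals A).mem_at_top.2 (isSubstructure_rationals.mul_mem _ ⟨_, rfl⟩ _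
        ((rationals A).mem_at_top.1 hx)) }

/-- A value 0 below a nonzero condition would make `x` agree with 0 there, so every value of `x` is
invertible. This keeps inverses inside the image of 𝐐. -/
theorem _root_.CondRat.mul_inv {x : (gen A ℚ).obj ⊤} (h : Apart x (gen.const 0)) :
    (condRat A).mul.toFun (x, (gen.map A fun x : ℚ => x⁻¹).toFun x) = gen.const 1 := by
  refine gen.eq_of_dense fun c hc => ?_
  obtain ⟨d, hd, hd0, s, hs⟩ := exists_val x.2 hc
  have s0 : s ≠ 0 := by
    rintro rfl
    exact hd0 (h d (gen.γ_const hs))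
  exact ⟨d, hd, hd0, 1, (gen.le_map₂ (fun x y : ℚ => x * y) hs
    (gen.le_map (fun x : ℚ => x⁻¹) hs)).trans_eq (congrArg _ (mul_inv_cancel₀ s0)),
    gen.le_const 1 d⟩

end condReal

namespace CondSet.Stable

variable {A : Type u} [CompleteBooleanAlgebra A] {X : CondSet.{u, v} A} {K : X.Stable}

theorem γ_eq_iff {b : A} {x y : K.toCondSet.obj ⊤} :
    K.toCondSet.γ b x = K.toCondSet.γ b y ↔ X.γ b x.1 = X.γ b y.1 := Subtype.ext_iff

end CondSet.Stable

/-! ### Order induced on a conditional subset -/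

namespace CondOrderedStr

variable {A : Type u} [CompleteBooleanAlgebra A] {S : CondOrderedStr.{u, v} A}
  {K : S.carrier.Stable} (h : S.IsSubstructure K)

theorem induced_le {x y : K.toCondSet.obj ⊤} :
    (S.induced K h).le.le ⊤ x y ↔ S.le.le ⊤ x.1 y.1 :=
  (Rel.le_top (r := (S.induced K h).le)).trans (Rel.le_top (r := S.le)).symm

theorem induced_le_γ (hS : S.le.IsTotalOrder) {b : A} {x y : K.toCondSet.obj ⊤} :
    (S.induced K h).le.le b (K.toCondSet.γ b x) (K.toCondSet.γ b y) ↔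
      S.le.le b (S.carrier.γ b x.1) (S.carrier.γ b y.1) := by
  constructor
  · rintro ⟨⟨u, v⟩, huv, e⟩
    exact ⟨(u.1, v.1), huv, Prod.ext (congrArg (fun z => z.1.1) e) (congrArg (fun z => z.2.1) e)⟩
  · rintro ⟨⟨u, v⟩, huv, e⟩
    -- The witnesses `u` and `v` need not lie in `K`. They are replaced by `z`, equal to `x` on `b`
    -- and to `y` off `b`, and by `y`; off `b` the comparison is reflexivity.
    obtain ⟨z, h1, h2⟩ := K.toCondSet.exists_mix b x y
    refine ⟨(z, y), ?_, Prod.ext h1 rfl⟩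
    refine S.le.mix b (x := (u, v)) (y := (y.1, y.1)) huv (Rel.le_top.1 (hS.refl y.1))
      (Prod.ext ?_ ?_) (Prod.ext ?_ rfl)
    · exact (congrArg Subtype.val h1).trans (congrArg Prod.fst e).symm
    · exact (congrArg Prod.snd e).symm
    · exact congrArg Subtype.val h2

theorem induced_lt_γ (hS : S.le.IsTotalOrder) {b : A} {x y : K.toCondSet.obj ⊤} :
    (S.induced K h).le.lt b (K.toCondSet.γ b x) (K.toCondSet.γ b y) ↔
      S.le.lt b (S.carrier.γ b x.1) (S.carrier.γ b y.1) := by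
  refine and_congr (induced_le_γ h hS) (forall_congr' fun c => forall_congr' fun hc => ?_)
  change (K.toCondSet.res c _ = K.toCondSet.res c _ → _) ↔ _
  -- Restrictions in `K` and in the ambient set use separately chosen preimages; `res_γ` removes the
  -- choices.
  rw [res_γ _ hc, res_γ _ hc, res_γ _ hc, res_γ _ hc, Stable.γ_eq_iff]

theorem induced_lt (hS : S.le.IsTotalOrder) {x y : K.toCondSet.obj ⊤} :
    (S.induced K h).le.lt ⊤ x y ↔ S.le.lt ⊤ x.1 y.1 := by
  have := induced_lt_γ h hS (b := ⊤) (x := x) (y := y)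
  rwa [K.toCondSet.identity, K.toCondSet.identity, S.carrier.identity, S.carrier.identity] at this

theorem induced_isTotalOrder (hS : S.le.IsTotalOrder) :
    (S.induced K h).le.IsTotalOrder where
  refl x := (induced_le h).2 (hS.refl x.1)
  trans x y z h₁ h₂ := (induced_le h).2
    (hS.trans x.1 y.1 z.1 ((induced_le h).1 h₁) ((induced_le h).1 h₂))
  antisymm x y h₁ h₂ :=
    Subtype.ext (hS.antisymm x.1 y.1 ((induced_le h).1 h₁) ((induced_le h).1 h₂))
  total x y := by
    obtain ⟨a, b, c, hp, h1, h2, h3⟩ := hS.total x.1 y.1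
    exact ⟨a, b, c, hp, (induced_lt_γ h hS).2 h1, (induced_lt_γ h hS).2 h2, Stable.γ_eq_iff.2 h3⟩

end CondOrderedStr

/-! ### The rational subfield and its isomorphism with the conditional rationals -/

namespace condReal

variable {A : Type u} [CompleteBooleanAlgebra A]

/-- The ring axioms come from the subring and the order axioms from the ambient order. Only inverses
need an argument: they are formed in 𝐐 and carried over by `ofRat`. -/
theorem isOrderedField_rationals :
    ((condReal A).induced (rationals A) isSubstructure_rationals).IsOrderedField where
  total := induced_isTotalOrder _ isTotalOrder
  field := by
    let _ := commRing (A := A)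
    have hap : ∀ x : (rationals A).toCondSet.obj ⊤, ∀ y : (gen A ℚ).obj ⊤,
        Apart x ⟨ofRat y, mem_rationals y⟩ ↔ Apart x.1 (ofRat y) := fun x y =>
      forall_congr' fun b => imp_congr_left Stable.γ_eq_iff
    refine ⟨(rationalSubring A).toCommRing, fun _ _ => rfl, fun _ _ => rfl,
      (hap _ _).2 apart_one_zero, fun x hx => ?_, fun x y z h => ?_, fun x y h h' => ?_⟩
    · have hx' := (hap _ _).1 hx
      obtain ⟨q, rfl⟩ := exists_ofRat x
      have hq : Apart q (gen.const 0) := fun b hb => hx' b (γ_ofRat.2 hb)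
      have h1 := congrArg ofRat (CondRat.mul_inv hq)
      rw [ofRat_mul] at h1
      exact ⟨⟨_, mem_rationals _⟩, (hap _ _).2 (apart_of_mul_eq_one h1), Subtype.ext h1,
        Subtype.ext ((commRing.mul_comm _ _).trans h1)⟩
    · exact (induced_lt _ isTotalOrder).2
        (add_lt_add z.1 ((induced_lt isSubstructure_rationals isTotalOrder).1 h))
    · exact (induced_lt _ isTotalOrder).2
        (mul_pos ((induced_lt isSubstructure_rationals isTotalOrder).1 h)
          ((induced_lt isSubstructure_rationals isTotalOrder).1 h'))

/-- The conditional function from the conditional rational numbers onto their image. -/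
noncomputable def ratHom (A : Type u) [CompleteBooleanAlgebra A] :
    Hom (condRat A).carrier
      ((condReal A).induced (rationals A) isSubstructure_rationals).carrier :=
  Hom.mk' (fun x => ⟨ofRat x, mem_rationals x⟩)
    (fun _ _ _ h => Stable.γ_eq_iff.2 (γ_ofRat.2 h))

theorem isIso_ratHom : CondOrderedStr.IsIso (ratHom A) where
  bijective := by
    refine ⟨fun b x y h => ?_, fun y => ?_⟩
    · obtain ⟨x, rfl⟩ := (condRat A).carrier.surjective b x
      obtain ⟨y, rfl⟩ := (condRat A).carrier.surjective b y
      rw [Hom.comp_γ, Hom.comp_γ] at h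
      exact γ_ofRat.1 (congrArg Subtype.val h)
    · obtain ⟨x, rfl⟩ := exists_ofRat y
      exact ⟨x, rfl⟩
  map_add _ _ := rfl
  map_mul _ _ := rfl
  map_le _ _ := ofRat_le

end condReal

end RationalSubfield

theorem mainTheorem7 (A : Type u) [CompleteBooleanAlgebra A] [Nontrivial A] :
    (condReal A).IsOrderedField ∧
    ∃ (K : (condReal A).carrier.Stable) (h : (condReal A).IsSubstructure K),
      ((condReal A).induced K h).IsOrderedField ∧
      ∃ f : CondSet.Hom (condRat A).carrier ((condReal A).induced K h).carrier,
        CondOrderedStr.IsIso f :=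
  ⟨condReal.isOrderedField, condReal.rationals A, condReal.isSubstructure_rationals,
    condReal.isOrderedField_rationals, condReal.ratHom A, condReal.isIso_ratHom⟩
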